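/- **Setting.** Let $n\ge 1$, let $f_1,\dots,f_n:\mathbb R^d\to\mathbb R$ be convex and differentiable with $L$-Lipschitz gradients ($L>0$), let $h:\mathbb R^d\to\mathbb R$ be convex, and put $f=\frac1n\sum_{i=1}^n f_i$, $F=f+h$. Let $x^*$ be a minimizer of $F$. Fix a step size $\gamma>0$, an integer $\tau\ge 0$, $\theta_2=\frac12$, parameters $\theta_1^s$ and $a^s=1-\theta_2-\theta_1^s$. **Algorithm (AASVRG).** Start from a point $x^0$: $x^0_0=z^0_0=\tilde x^0=x^0$. For epochs $s=0,1,2,\dots$ and, inside epoch $s$, for $k=0,\dots,n-1$, put $$w^s_{j(k)}=x^s_{j(k)}+\frac{a^s\bigl(1-(a^s)^{k-j(k)+1}\bigr)}{1-a^s}\bigl(x^s_{j(k)}-x^s_{j(k)-1}\bigr),$$ where $j(k)=j^s(k)$ is the delayed state; draw $i^s_k$ uniformly from $\{1,\dots,n\}$; put $\tilde\nabla^s_k=\nabla f_{i^s_k}(w^s_{j(k)})-\nabla f_{i^s_k}(\tilde x^s)+\nabla f(\tilde x^s)$, and $$\delta^s_k=\operatorname*{arg\,min}_\delta\ h(z^s_k+\delta)+\langle\tilde\nabla^s_k,\delta\rangle+\frac{\theta^s_1}{2\gamma}\|\delta\|^2,\quad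 z^s_{k+1}=z^s_k+\delta^s_k,\quad x^s_{k+1}=\theta^s_1z^s_{k+1}+\theta_2\tilde x^s+a^sx^s_k .$$ For $j(k)=0$, where $x^s_{-1}$ has no meaning, $a^s(x^s_0-x^s_{-1})$ stands for $y^s_0-x^s_0$ with $y^s_0=\theta_1^sz^s_0+\theta_2\tilde x^s+a^sx^s_0$ (for $j\ge1$ one has $a^s(x^s_j-x^s_{j-1})=y^s_j-x^s_j$ in the same way). After each epoch $x^{s+1}_0=x^s_n$, $z^{s+1}_0=z^s_n$, and the new snapshot is $$\tilde x^{s+1}=\frac1n\sum_{k=0}^{n-1}x^s_{k+1}\ \text{ (non-strongly convex case)},\qquad \tilde x^{s+1}=\Bigl(\sum_{k=0}^{n-1}\theta_3^k\Bigr)^{-1}\sum_{k=0}^{n-1}\theta_3^k\,x^s_{k+1}\ \text{ (strongly convex case)},$$ with $\theta_3$ as below. **Delays and sampling.** $\max(0,k-\tau)\le j^s(k)\le k$. The delays may be random, but $j^s(k)$ is determined by information available before $i^s_k$ is drawn, and $i^s_k$ is independent of that information, which includes all previously drawn indices. **Theorem.** Let $S\ge 0$. (1) *Non-strongly convex case.*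 If $5\gamma L+10\gamma L\tau^2\le 1$ and $\theta_1^s=\frac{2}{s+4}$, then $$\mathbb E\bigl(F(x^S_n)-F(x^*)\bigr)+(\theta_2+\theta_1^S)\sum_{k=1}^{n-1}\mathbb E\bigl(F(x^S_k)-F(x^*)\bigr)\le 2n(\theta_1^S)^2\bigl(F(x^0)-F(x^*)\bigr)+\frac{(\theta_1^S)^2}{2\gamma}\|x^0-x^*\|^2 .$$ (2) *Strongly convex case.* If $h$ is strongly convex with modulus $\mu>0$, $\mu\le\frac{L\tau^2}{4n}$, $5\gamma L+\frac{95}{8}\tau^2\gamma L\le 1$, $\theta_1^s=\frac1\tau\sqrt{\frac{n\mu}{L}}$ for all $s$, and $\theta_3=1+\frac{\mu\gamma}{\theta_1^s}$, then $$\mathbb E\,F(\tilde x^{S+1})-F(x^*)\le\theta_3^{-Sn}\left(\Bigl(1+\frac1n\Bigr)\bigl(F(x^0)-F(x^*)\bigr)+\frac{1}{4n\gamma}\|x^0-x^*\|^2\right).$$ All these expectations are finite. -/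

import Mathlib

open MeasureTheory ProbabilityTheory

namespace AASVRG

/-- The space `ℝ^d` with its Euclidean norm. -/
abbrev E (d : ℕ) : Type := EuclideanSpace ℝ (Fin d)

/-- `g` is differentiable and its gradient is `L`-Lipschitz. -/
def LSmooth {d : ℕ} (L : ℝ) (g : E d → ℝ) : Prop :=
  Differentiable ℝ g ∧ ∀ x y : E d, ‖gradient g x - gradient g y‖ ≤ L * ‖x - y‖

/-- The smooth part `f = (1/n) ∑ f_r`. -/
noncomputable def fAvg {d n : ℕ} (f : Fin n → E d → ℝ) (x : E d) : ℝ :=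
  (1 / (n : ℝ)) * ∑ r, f r x

/-- The objective `F = h + (1/n) ∑ f_r`. -/
noncomputable def objective {d n : ℕ} (f : Fin n → E d → ℝ) (h : E d → ℝ) (x : E d) : ℝ :=
  h x + fAvg f x

/-- The momentum weight `a = 1 - θ₂ - θ₁` with `θ₂ = 1/2`. -/
noncomputable def aCoef (θ₁ : ℝ) : ℝ := 1 - 1 / 2 - θ₁

/-- The extrapolation point `y = θ₁ z + θ₂ x̃ + a x` with `θ₂ = 1/2`. -/
noncomputable def extrap {d : ℕ} (θ₁ : ℝ) (z xt x : E d) : E d :=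
  θ₁ • z + (1 / 2 : ℝ) • xt + aCoef θ₁ • x

/-- One momentum step `y_j - x_j` at the state `j` of an epoch with inner iterates `x`, `z` and
snapshot `xt`: it equals `a (x_j - x_{j-1})` for `j ≥ 1`, and for `j = 0`, where the epoch has no
previous iterate, it is `y_0 - x_0`. -/
noncomputable def momentum {d : ℕ} (θ₁ : ℝ) (x z : ℕ → E d) (xt : E d) (j : ℕ) : E d :=
  if j = 0 then extrap θ₁ (z 0) xt (x 0) - x 0 else aCoef θ₁ • (x j - x (j - 1))

/-- The compensated point `w_j = x_j + (a (1 - a^(k-j+1)) / (1 - a)) (x_j - x_{j-1})` used at inner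
iteration `k` when the delayed state is `j`. -/
noncomputable def compensated {d : ℕ} (θ₁ : ℝ) (x z : ℕ → E d) (xt : E d) (j k : ℕ) : E d :=
  x j + ((1 - aCoef θ₁ ^ (k - j + 1)) / (1 - aCoef θ₁)) • momentum θ₁ x z xt j

/-- The variance reduced gradient `∇f_r(w) - ∇f_r(x̃) + ∇f(x̃)`. -/
noncomputable def vrGrad {d n : ℕ} (f : Fin n → E d → ℝ) (r : Fin n) (w xt : E d) : E d :=
  gradient (f r) w - gradient (f r) xt + gradient (fAvg f) xt

/-- The function minimized over the increment `δ` in the proximal step. -/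
noncomputable def proxObjective {d : ℕ} (h : E d → ℝ) (θ₁ γ : ℝ) (z g δ : E d) : ℝ :=
  h (z + δ) + inner ℝ g δ + θ₁ / (2 * γ) * ‖δ‖ ^ 2

/-- `x s k`, `z s k` (epoch `s`, inner index `0 ≤ k ≤ n`) and the snapshots `xt s` are the iterates
of the method started at `x₀`, with `m = n` inner iterations per epoch, momentum parameters `θ₁ s`,
step size `γ`, sampled indices `i s k` and delayed states `j s k`. The next snapshot is the average
of the new iterates `x s 1, …, x s n` with weights proportional to `ρ^0, …, ρ^(n-1)`. -/
structure IsRun {d n : ℕ} (f : Fin n → E d → ℝ) (h : E d → ℝ) (γ : ℝ) (θ₁ : ℕ → ℝ) (ρ : ℝ)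
    (x₀ : E d) (i : ℕ → ℕ → Fin n) (j : ℕ → ℕ → ℕ)
    (x z : ℕ → ℕ → E d) (xt : ℕ → E d) : Prop where
  x_init : x 0 0 = x₀
  z_init : z 0 0 = x₀
  xt_init : xt 0 = x₀
  z_step : ∀ s k, k < n →
    IsMinOn
      (proxObjective h (θ₁ s) γ (z s k)
        (vrGrad f (i s k) (compensated (θ₁ s) (x s) (z s) (xt s) (j s k) k) (xt s)))
      Set.univ (z s (k + 1) - z s k)
  x_step : ∀ s k, k < n →
    x s (k + 1) = θ₁ s • z s (k + 1) + (1 / 2 : ℝ) • xt s + aCoef (θ₁ s) • x s k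
  x_sync : ∀ s, x (s + 1) 0 = x s n
  z_sync : ∀ s, z (s + 1) 0 = z s n
  xt_sync : ∀ s, xt (s + 1) =
    (∑ k ∈ Finset.range n, ρ ^ k)⁻¹ • ∑ k ∈ Finset.range n, ρ ^ k • x s (k + 1)

/-- Sampling and delays. Inner iteration `k` of epoch `s` has the global number `s * n + k`, and
`ℱ t` is the information available before the index of global iteration `t` is drawn. The index is
uniform on the `n` components and independent of that information, and the delayed state is known
beforehand, lies in the current epoch, and is at most `τ` iterations old. -/
structure AsyncSampling {Ω : Type*} {mΩ : MeasurableSpace Ω} (P : Measure Ω)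
    (ℱ : Filtration ℕ mΩ) (n τ : ℕ) (i : ℕ → ℕ → Ω → Fin n) (j : ℕ → ℕ → Ω → ℕ) : Prop where
  i_meas : ∀ s k, k < n → Measurable[ℱ (s * n + k + 1)] (i s k)
  i_uniform : ∀ s k, k < n → ∀ r : Fin n, P (i s k ⁻¹' {r}) = (n : ENNReal)⁻¹
  i_indep : ∀ s k, k < n → Indep (MeasurableSpace.comap (i s k) ⊤) (ℱ (s * n + k)) P
  j_meas : ∀ s k, k < n → Measurable[ℱ (s * n + k)] (j s k)
  j_le : ∀ s k, k < n → ∀ ω, j s k ω ≤ k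
  j_delay : ∀ s k, k < n → ∀ ω, k ≤ j s k ω + τ

end AASVRG

/-! Write `y = θ z + x̃/2 + a x`, so that the new iterate is `y + θ (z' - z)`, and let `w` be the
point where the gradient is evaluated. The descent lemma at `w`, convexity towards `x` and `x*`, and
the strong convexity of the proximal subproblem bound the new gap by a three-point inequality
(`one_step_le`) with two error terms.

The first is the variance of the sampled gradient. By cocoercivity its mean is at most `2L` times
the Bregman divergence from `w` to the snapshot. Weighted by `1/(4L)`, this is exactly the half
divergence left over because the linearization towards `x̃` (weight `1/2`) is kept exact.

The second is the delay error `L ‖y - w‖²`. The compensation makes `y - w` a combination of the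
increments `θ (z_{l+1} - z_l)` made since the delayed state, with coefficients at most `2`
(`extrap_sub_compensated`). Over an epoch each squared increment is counted at most `τ` times, and
the step size condition lets the proximal term `-‖θ (z' - z)‖²/(2γ)` absorb all of them
(`epoch_sum_le`).

Taking expectations needs no regularity of the proximal map: indices and delays take finitely many
values, hence so do all iterates. The epoch inequalities are then chained, after rescaling by `θ_s²`
in the convex case (`chain_convex`), and with the factor `ρ = 1 + μγ/θ` gained per inner step in the
strongly convex case (`chain_strongly_convex`). -/

namespace AASVRG

/-! ### Smooth convex functions: descent lemma and cocoercivity. -/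

section ConvexAnalysis

variable {V : Type*} [NormedAddCommGroup V] [InnerProductSpace ℝ V]

theorem norm_sq_segment (u v : V) (t : ℝ) :
    ‖(1 - t) • u + t • v‖ ^ 2 = (1 - t) * ‖u‖ ^ 2 + t * ‖v‖ ^ 2 - t * (1 - t) * ‖v - u‖ ^ 2 := by
  rw [norm_add_sq_real, norm_sub_sq_real, norm_smul, norm_smul, inner_smul_left, inner_smul_right,
    mul_pow, mul_pow, Real.norm_eq_abs, Real.norm_eq_abs, sq_abs, sq_abs, real_inner_comm v u]
  simp only [conj_trivial]
  ring

/-- This is the limit `t → 0`, made explicit: if `D = A + B - C` were positive, `t = D / (2 (B +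
D))` would lose at most `D / 2`. -/
theorem add_le_of_forall_one_sub_mul_le {A B C : ℝ} (hB : 0 ≤ B)
    (h : ∀ t : ℝ, 0 < t → t < 1 → A + (1 - t) * B ≤ C) : A + B ≤ C := by
  by_contra! hlt
  have he : 0 < A + B - C := by linarith
  have hpos : 0 < 2 * (B + (A + B - C)) := by linarith
  have := h ((A + B - C) / (2 * (B + (A + B - C)))) (by positivity)
    (by rw [div_lt_one hpos]; linarith)
  have h2 : (A + B - C) / (2 * (B + (A + B - C))) * B ≤ (A + B - C) / 2 := by
    rw [div_mul_eq_mul_div, div_le_div_iff₀ hpos two_pos]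
    nlinarith
  linarith

variable [CompleteSpace V]

theorem hasDerivAt_comp_line {g : V → ℝ} (hg : Differentiable ℝ g) (w d : V) (t : ℝ) :
    HasDerivAt (fun t : ℝ => g (w + t • d)) (inner ℝ (gradient g (w + t • d)) d) t := by
  have h1 : HasDerivAt (fun t : ℝ => w + t • d) d t := by
    simpa using ((hasDerivAt_id t).smul_const d).const_add w
  have h2 := ((hg (w + t • d)).hasGradientAt.hasFDerivAt).comp_hasDerivAt t h1
  exact h2

theorem inner_gradient_le_sub {g : V → ℝ} (hc : ConvexOn ℝ Set.univ g)
    (hg : Differentiable ℝ g) (w u : V) :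
    g w + inner ℝ (gradient g w) (u - w) ≤ g u := by
  have hconv : ConvexOn ℝ Set.univ (fun t : ℝ => g (w + t • (u - w))) := by
    have := hc.comp_affineMap (AffineMap.lineMap w u : ℝ →ᵃ[ℝ] V)
    simpa [Function.comp_def, AffineMap.lineMap_apply, add_comm] using this
  have h := hconv.le_slope_of_hasDerivAt (Set.mem_univ 0) (Set.mem_univ 1) one_pos
    (hasDerivAt_comp_line hg w (u - w) 0)
  simp only [slope_def_field, zero_smul, add_zero, one_smul, add_sub_cancel, sub_zero, div_one]
    at h
  linarith

theorem le_add_inner_gradient_add {g : V → ℝ} {L : ℝ} (hg : Differentiable ℝ g)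
    (hL : ∀ x y, ‖gradient g x - gradient g y‖ ≤ L * ‖x - y‖) (w u : V) :
    g u ≤ g w + inner ℝ (gradient g w) (u - w) + L / 2 * ‖u - w‖ ^ 2 := by
  set d := u - w with hd
  -- `ψ` is `g` along the segment minus the non-constant part of its quadratic upper model; the
  -- Lipschitz bound makes `ψ' ≤ 0` on `(0, 1)`.
  let ψ : ℝ → ℝ := fun t =>
    g (w + t • d) - (t * inner ℝ (gradient g w) d + L / 2 * ‖d‖ ^ 2 * t ^ 2)
  have hψ : ∀ t, HasDerivAt ψ (inner ℝ (gradient g (w + t • d)) d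
      - (1 * inner ℝ (gradient g w) d + L / 2 * ‖d‖ ^ 2 * (2 * t))) t := fun t => by
    have h3 := (hasDerivAt_comp_line hg w d t).fun_sub
      (((hasDerivAt_id' t).mul_const (inner ℝ (gradient g w) d)).fun_add
        ((hasDerivAt_pow 2 t).const_mul (L / 2 * ‖d‖ ^ 2)))
    norm_num only [pow_one, Nat.cast_ofNat, Nat.reduceSub] at h3
    convert h3 using 1
  have hanti : AntitoneOn ψ (Set.Icc 0 1) := by
    refine antitoneOn_of_deriv_nonpos (convex_Icc 0 1)
      (fun t _ => (hψ t).continuousAt.continuousWithinAt)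
      (fun t _ => (hψ t).differentiableAt.differentiableWithinAt) fun t ht => ?_
    rw [interior_Icc] at ht
    rw [(hψ t).deriv]
    have h1 : inner ℝ (gradient g (w + t • d) - gradient g w) d ≤ L * (t * ‖d‖) * ‖d‖ := by
      refine (real_inner_le_norm _ _).trans (mul_le_mul_of_nonneg_right ?_ (norm_nonneg _))
      refine (hL _ _).trans_eq ?_
      rw [add_sub_cancel_left, norm_smul, Real.norm_of_nonneg ht.1.le]
    rw [inner_sub_left] at h1
    nlinarith
  have := hanti (Set.left_mem_Icc.2 zero_le_one) (Set.right_mem_Icc.2 zero_le_one) zero_le_one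
  simp only [ψ, zero_smul, add_zero, one_smul, hd, add_sub_cancel] at this
  linarith

/-- Cocoercivity of the gradient of a smooth convex function, in terms of its Bregman divergence. -/
theorem norm_gradient_sub_sq_le {g : V → ℝ} {L : ℝ} (hL0 : 0 < L) (hc : ConvexOn ℝ Set.univ g)
    (hg : Differentiable ℝ g) (hL : ∀ x y, ‖gradient g x - gradient g y‖ ≤ L * ‖x - y‖) (w v : V) :
    ‖gradient g w - gradient g v‖ ^ 2 ≤ 2 * L * (g v - g w - inner ℝ (gradient g w) (v - w)) := by
  set D := gradient g w - gradient g v with hD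
  -- The test point `v + D / L` minimizes the quadratic upper model at `v` minus the linearization
  -- at `w`, so comparing the two there gives the sharpest bound.
  have h1 := inner_gradient_le_sub hc hg w (v + L⁻¹ • D)
  have h2 := le_add_inner_gradient_add hg hL v (v + L⁻¹ • D)
  have h3 : inner ℝ (gradient g w) (v + L⁻¹ • D - w)
      = inner ℝ (gradient g w) (v - w) + L⁻¹ * inner ℝ (gradient g w) D := by
    rw [← real_inner_smul_right, ← inner_add_right]
    congr 1
    abel
  have h4 : inner ℝ (gradient g w) D - inner ℝ (gradient g v) D = ‖D‖ ^ 2 := by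
    rw [← inner_sub_left, ← hD, real_inner_self_eq_norm_sq]
  rw [h3] at h1
  rw [add_sub_cancel_left, inner_smul_right, norm_smul, mul_pow, Real.norm_eq_abs, sq_abs] at h2
  have h5 : L / 2 * (L⁻¹ ^ 2 * ‖D‖ ^ 2) = L⁻¹ / 2 * ‖D‖ ^ 2 := by field_simp
  rw [h5] at h2
  have h6 : L⁻¹ / 2 * ‖D‖ ^ 2 ≤ g v - g w - inner ℝ (gradient g w) (v - w) := by
    have : L⁻¹ * inner ℝ (gradient g w) D - L⁻¹ * inner ℝ (gradient g v) D = L⁻¹ * ‖D‖ ^ 2 := by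
      rw [← mul_sub, h4]
    linarith
  calc ‖D‖ ^ 2 = 2 * L * (L⁻¹ / 2 * ‖D‖ ^ 2) := by field_simp
    _ ≤ _ := by gcongr

end ConvexAnalysis

/-! ### The proximal subproblem. -/

section Prox

variable {d : ℕ} {h : E d → ℝ} {μ θ γ : ℝ}

/-- Quadratic growth of the proximal objective around its minimizer. -/
theorem proxObjective_growth (hμ : 0 ≤ μ) (hθ : 0 < θ) (hγ : 0 < γ)
    (hh : StrongConvexOn Set.univ μ h) {z g δ : E d}
    (hmin : IsMinOn (proxObjective h θ γ z g) Set.univ δ) (u : E d) :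
    proxObjective h θ γ z g δ + (θ / (2 * γ) + μ / 2) * ‖u - δ‖ ^ 2 ≤ proxObjective h θ γ z g u := by
  -- Compare `δ` with the point `(1 - t) δ + t u`, divide by `t`, and let `t → 0`.
  refine add_le_of_forall_one_sub_mul_le (by positivity) fun t ht0 ht1 => ?_
  have h1 := isMinOn_univ_iff.1 hmin ((1 - t) • δ + t • u)
  have h2 := hh.2 (Set.mem_univ (z + δ)) (Set.mem_univ (z + u)) (sub_nonneg.2 ht1.le) ht0.le
    (by ring)
  have h3 : (1 - t) • (z + δ) + t • (z + u) = z + ((1 - t) • δ + t • u) := by module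
  have h4 : z + δ - (z + u) = -(u - δ) := by abel
  rw [h3, h4, norm_neg] at h2
  simp only [proxObjective, norm_sq_segment, inner_add_right, inner_smul_right, smul_eq_mul]
    at h1 h2 ⊢
  have h5 : t * (h (z + δ) + inner ℝ g δ + θ / (2 * γ) * ‖δ‖ ^ 2
      + (1 - t) * ((θ / (2 * γ) + μ / 2) * ‖u - δ‖ ^ 2))
      ≤ t * (h (z + u) + inner ℝ g u + θ / (2 * γ) * ‖u‖ ^ 2) := by
    linear_combination h1 + h2
  exact le_of_mul_le_mul_left h5 ht0

theorem proxObjective_minimizer_unique (hθ : 0 < θ) (hγ : 0 < γ)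
    (hh : ConvexOn ℝ Set.univ h) {z g δ δ' : E d}
    (hmin : IsMinOn (proxObjective h θ γ z g) Set.univ δ)
    (hmin' : IsMinOn (proxObjective h θ γ z g) Set.univ δ') : δ = δ' := by
  have h1 := proxObjective_growth le_rfl hθ hγ (strongConvexOn_zero.2 hh) hmin δ'
  have h2 := isMinOn_univ_iff.1 hmin' δ
  have h3 : 0 < θ / (2 * γ) + 0 / 2 := by positivity
  have h4 : ‖δ' - δ‖ ^ 2 ≤ 0 := by
    by_contra! hlt
    nlinarith [mul_pos h3 hlt]
  have h5 : ‖δ' - δ‖ = 0 := by nlinarith [norm_nonneg (δ' - δ)]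
  exact (sub_eq_zero.1 (norm_eq_zero.1 h5)).symm

end Prox

/-! ### The averaged function and the variance of its reduced gradient. -/

section FiniteSum

variable {d n : ℕ} {f : Fin n → E d → ℝ} {L : ℝ}

theorem hasGradientAt_fAvg (hf : ∀ r, Differentiable ℝ (f r)) (x : E d) :
    HasGradientAt (fAvg f) ((1 / (n : ℝ)) • ∑ r, gradient (f r) x) x := by
  rw [hasGradientAt_iff_hasFDerivAt, map_smul, map_sum]
  have h1 : HasFDerivAt (fun y => ∑ r, f r y)
      (∑ r, InnerProductSpace.toDual ℝ (E d) (gradient (f r) x)) x :=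
    HasFDerivAt.fun_sum fun r _ => ((hf r) x).hasGradientAt.hasFDerivAt
  exact h1.const_mul (1 / (n : ℝ))

theorem gradient_fAvg (hf : ∀ r, Differentiable ℝ (f r)) (x : E d) :
    gradient (fAvg f) x = (1 / (n : ℝ)) • ∑ r, gradient (f r) x :=
  (hasGradientAt_fAvg hf x).gradient

theorem convexOn_fAvg (hf : ∀ r, ConvexOn ℝ Set.univ (f r)) : ConvexOn ℝ Set.univ (fAvg f) := by
  have h : ConvexOn ℝ Set.univ (fun x => ∑ r, f r x) := by
    refine ⟨convex_univ, fun x _ y _ a b ha hb hab => ?_⟩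
    simp only [smul_eq_mul, Finset.mul_sum, ← Finset.sum_add_distrib]
    exact Finset.sum_le_sum fun r _ => (hf r).2 (Set.mem_univ x) (Set.mem_univ y) ha hb hab
  exact h.smul (by positivity : (0 : ℝ) ≤ 1 / n)

theorem LSmooth.fAvg (hn : 0 < n) (hf : ∀ r, LSmooth L (f r)) : LSmooth L (fAvg f) := by
  have hd := fun r => (hf r).1
  refine ⟨fun x => (hasGradientAt_fAvg hd x).differentiableAt, fun x y => ?_⟩
  rw [gradient_fAvg hd, gradient_fAvg hd, ← smul_sub, ← Finset.sum_sub_distrib, norm_smul,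
    Real.norm_of_nonneg (by positivity)]
  have h1 : ‖∑ r, (gradient (f r) x - gradient (f r) y)‖ ≤ n * (L * ‖x - y‖) := by
    refine (norm_sum_le _ _).trans ?_
    refine (Finset.sum_le_sum fun r _ => (hf r).2 x y).trans_eq ?_
    simp
  have hn' : (0 : ℝ) < n := by exact_mod_cast hn
  calc 1 / (n : ℝ) * ‖∑ r, (gradient (f r) x - gradient (f r) y)‖
      ≤ 1 / (n : ℝ) * (n * (L * ‖x - y‖)) := by gcongr
    _ = _ := by field_simp

/-- The Bregman divergence `f(v) - f(w) - ⟨∇f(w), v - w⟩` of the averaged function. -/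
noncomputable def bregman (f : Fin n → E d → ℝ) (w v : E d) : ℝ :=
  fAvg f v - fAvg f w - inner ℝ (gradient (fAvg f) w) (v - w)

theorem sum_gradient_sub_vrGrad (hn : 0 < n) (hf : ∀ r, Differentiable ℝ (f r)) (w v : E d) :
    ∑ r, (gradient (fAvg f) w - vrGrad f r w v) = 0 := by
  have hn' : (n : ℝ) ≠ 0 := by positivity
  have h : ∀ y, ∑ r, gradient (f r) y = (n : ℝ) • gradient (fAvg f) y := fun y => by
    rw [gradient_fAvg hf, smul_smul, mul_one_div_cancel hn', one_smul]
  simp only [vrGrad, Finset.sum_sub_distrib, Finset.sum_add_distrib, h, Finset.sum_const,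
    Finset.card_univ, Fintype.card_fin, ← Nat.cast_smul_eq_nsmul ℝ]
  abel

/-- The variance of the variance reduced gradient is bounded by the Bregman divergence. -/
theorem sum_norm_gradient_sub_vrGrad_sq_le (hn : 0 < n) (hL : 0 < L)
    (hc : ∀ r, ConvexOn ℝ Set.univ (f r)) (hf : ∀ r, LSmooth L (f r)) (w v : E d) :
    ∑ r, ‖gradient (fAvg f) w - vrGrad f r w v‖ ^ 2 ≤ n * (2 * L * bregman f w v) := by
  have hd := fun r => (hf r).1
  have hn' : (n : ℝ) ≠ 0 := by positivity
  have h0 : ∑ r, (gradient (f r) w - gradient (f r) v)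
      = (n : ℝ) • (gradient (fAvg f) w - gradient (fAvg f) v) := by
    rw [gradient_fAvg hd, gradient_fAvg hd, ← smul_sub, smul_smul, mul_one_div_cancel hn',
      one_smul, Finset.sum_sub_distrib]
  set m := gradient (fAvg f) w - gradient (fAvg f) v with hm
  -- The error is `m` minus a vector whose mean over `r` is `m`; after summation the squares give
  -- the second moment minus `n ‖m‖²`, and the latter is dropped.
  have h1 : ∀ r, ‖gradient (fAvg f) w - vrGrad f r w v‖ ^ 2
      = ‖m‖ ^ 2 - 2 * inner ℝ m (gradient (f r) w - gradient (f r) v)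
        + ‖gradient (f r) w - gradient (f r) v‖ ^ 2 := fun r => by
    rw [← norm_sub_sq_real]
    congr 2
    simp only [vrGrad, hm]
    abel
  have h2 : ∑ r, ‖gradient (f r) w - gradient (f r) v‖ ^ 2 ≤ n * (2 * L * bregman f w v) := by
    refine (Finset.sum_le_sum fun r _ =>
      norm_gradient_sub_sq_le hL (hc r) (hd r) (hf r).2 w v).trans_eq ?_
    rw [← Finset.mul_sum, Finset.sum_sub_distrib, Finset.sum_sub_distrib, ← sum_inner, bregman,
      gradient_fAvg hd, inner_smul_left, fAvg, fAvg]
    simp only [conj_trivial]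
    field_simp
  simp only [h1, Finset.sum_add_distrib, Finset.sum_sub_distrib, ← Finset.mul_sum, ← inner_sum, h0,
    inner_smul_right, real_inner_self_eq_norm_sq, Finset.sum_const, Finset.card_univ,
    Fintype.card_fin, nsmul_eq_mul]
  nlinarith [mul_nonneg (Nat.cast_nonneg (α := ℝ) n) (sq_nonneg ‖m‖)]

end FiniteSum

/-! ### Random variables with finitely many values. -/

section Simple

variable {Ω α β γ : Type*}

/-- `g` takes finitely many values, and its fibres are `m`-measurable. -/
def FiniteMeas (m : MeasurableSpace Ω) (g : Ω → α) : Prop :=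
  (Set.range g).Finite ∧ ∀ c, MeasurableSet[m] (g ⁻¹' {c})

variable {m m' : MeasurableSpace Ω}

theorem FiniteMeas.mono {g : Ω → α} (hg : FiniteMeas m g) (h : m ≤ m') : FiniteMeas m' g :=
  ⟨hg.1, fun c => h _ (hg.2 c)⟩

theorem finiteMeas_const (c : α) : FiniteMeas m (fun _ : Ω => c) :=
  ⟨Set.finite_range_const, fun d => by by_cases h : c = d <;> simp [h]⟩

/-- Split over the finitely many fibres of `g`. This handles random selection, by a delay or a
sampled index, and shows that composition with an arbitrary map, measurable or not, is harmless. -/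
theorem FiniteMeas.bind {g : Ω → α} (hg : FiniteMeas m g) {G : α → Ω → β}
    (hG : ∀ a ∈ Set.range g, FiniteMeas m (G a)) : FiniteMeas m (fun ω => G (g ω) ω) := by
  refine ⟨(hg.1.biUnion fun a ha => (hG a ha).1).subset ?_, fun c => ?_⟩
  · rintro _ ⟨ω, rfl⟩
    exact Set.mem_biUnion (Set.mem_range_self ω) (Set.mem_range_self ω)
  · have h : (fun ω => G (g ω) ω) ⁻¹' {c} = ⋃ a ∈ Set.range g, g ⁻¹' {a} ∩ G a ⁻¹' {c} := by
      ext ω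
      simp only [Set.mem_preimage, Set.mem_singleton_iff, Set.mem_iUnion, Set.mem_inter_iff]
      exact ⟨fun hω => ⟨g ω, Set.mem_range_self ω, rfl, hω⟩, fun ⟨a, _, ha, hω⟩ => ha ▸ hω⟩
    rw [h]
    exact Set.Finite.measurableSet_biUnion hg.1 fun a ha => (hg.2 a).inter ((hG a ha).2 c)

theorem FiniteMeas.map {g : Ω → α} (hg : FiniteMeas m g) (φ : α → β) :
    FiniteMeas m (fun ω => φ (g ω)) :=
  hg.bind fun a _ => finiteMeas_const (φ a)

theorem FiniteMeas.map₂ {g : Ω → α} {g' : Ω → β} (hg : FiniteMeas m g) (hg' : FiniteMeas m g')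
    (φ : α → β → γ) : FiniteMeas m (fun ω => φ (g ω) (g' ω)) :=
  hg.bind fun a _ => hg'.map (φ a)

theorem finiteMeas_sum {ι V : Type*} [AddCommMonoid V] (s : Finset ι) {G : ι → Ω → V}
    (hG : ∀ a ∈ s, FiniteMeas m (G a)) : FiniteMeas m (fun ω => ∑ a ∈ s, G a ω) := by
  classical
  induction s using Finset.induction_on with
  | empty => simpa using finiteMeas_const (m := m) (0 : V)
  | insert a s ha ih =>
    simp only [Finset.sum_insert ha]
    exact (hG a (by simp)).map₂ (ih fun b hb => hG b (by simp [hb])) (· + ·)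

theorem FiniteMeas.measurable {g : Ω → ℝ} (hg : FiniteMeas m g) : Measurable[m] g := by
  intro s _
  have h : g ⁻¹' s = ⋃ a ∈ Set.range g ∩ s, g ⁻¹' {a} := by
    ext ω
    simp
  rw [h]
  exact Set.Finite.measurableSet_biUnion (hg.1.inter_of_left s) fun a _ => hg.2 a

theorem FiniteMeas.integrable {g : Ω → ℝ} (hm : m ≤ m') (hg : FiniteMeas m g)
    (P : @Measure Ω m') [IsFiniteMeasure P] : Integrable g P := by
  obtain ⟨C, hC⟩ := (hg.1.isBounded).exists_norm_le
  exact Integrable.of_bound (hg.mono hm).measurable.aestronglyMeasurable C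
    (Filter.Eventually.of_forall fun ω => hC _ (Set.mem_range_self ω))

end Simple

/-- If `I` is uniform on the `n` indices and independent of `m`, then the mean of `G I` is at most
zero as soon as the average over the index of `G r` is at most zero. -/
theorem integral_uniform_index_le_zero {Ω : Type*} {m mΩ : MeasurableSpace Ω} (P : Measure Ω)
    [IsProbabilityMeasure P] (hm : m ≤ mΩ) {n : ℕ} {I : Ω → Fin n}
    (hI : Measurable I) (hu : ∀ r, P (I ⁻¹' {r}) = (n : ENNReal)⁻¹)
    (hind : Indep (MeasurableSpace.comap I ⊤) m P) {G : Fin n → Ω → ℝ}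
    (hG : ∀ r, FiniteMeas m (G r)) (hneg : ∀ ω, ∑ r, G r ω ≤ 0) :
    ∫ ω, G (I ω) ω ∂P ≤ 0 := by
  have hIm : ∀ r, MeasurableSet (I ⁻¹' {r}) := fun r => hI (measurableSet_singleton r)
  -- Splitting by the value of the index turns the mean into a sum of products of independent
  -- factors, each indicator having mean `1/n`.
  have h1 : ∀ ω, G (I ω) ω = ∑ r, (I ⁻¹' {r}).indicator (fun _ => (1 : ℝ)) ω * G r ω := fun ω => by
    rw [Finset.sum_eq_single (I ω)]
    · simp
    · intro r _ hr
      simp [Set.indicator, Ne.symm hr]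
    · simp
  have h2 : ∀ r, ∫ ω, (I ⁻¹' {r}).indicator (fun _ => (1 : ℝ)) ω * G r ω ∂P
      = (n : ℝ)⁻¹ * ∫ ω, G r ω ∂P := fun r => by
    have hid : IndepFun ((I ⁻¹' {r}).indicator (fun _ => (1 : ℝ))) (G r) P := by
      rw [IndepFun_iff_Indep]
      refine indep_of_indep_of_le_left (indep_of_indep_of_le_right hind
        (hG r).measurable.comap_le) ?_
      refine Measurable.comap_le ?_
      exact Measurable.indicator measurable_const ⟨{r}, trivial, rfl⟩
    rw [hid.integral_fun_mul_eq_mul_integral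
      ((measurable_const.indicator (hIm r)).aestronglyMeasurable)
      (((hG r).mono hm).measurable.aestronglyMeasurable), integral_indicator_const _ (hIm r)]
    simp [Measure.real, hu r]
  simp only [h1]
  rw [integral_finsetSum]
  · simp only [h2]
    rw [← Finset.mul_sum, ← integral_finsetSum _ fun r _ => (hG r).integrable hm P]
    exact mul_nonpos_of_nonneg_of_nonpos (by positivity) (integral_nonpos hneg)
  · intro r _
    refine Integrable.bdd_mul ((hG r).integrable hm P) (c := 1)
      ((measurable_const.indicator (hIm r)).aestronglyMeasurable)
      (Filter.Eventually.of_forall fun ω => ?_)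
    by_cases hω : ω ∈ I ⁻¹' {r} <;> simp [Set.indicator, hω]

/-! ### Deterministic recursions: one epoch, chaining of epochs, parameters. -/

section RealSequences

/-- Exchange the sums: `l` lies only in the windows of `k` with `l < k ≤ l + τ`, at most `τ` of
them. The weights are compared crudely by `ρ ^ k ≤ ρ ^ n ≤ ρ ^ n * ρ ^ l`. -/
theorem sum_delay_window_le {q : ℕ → ℝ} (hq : ∀ k, 0 ≤ q k) {ρ : ℝ} (hρ : 1 ≤ ρ) (n τ : ℕ) :
    ∑ k ∈ Finset.range n, ρ ^ k * ∑ l ∈ Finset.Ico (k - τ) k, q l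
      ≤ τ * ρ ^ n * ∑ l ∈ Finset.range n, ρ ^ l * q l := by
  have hρ0 : 0 ≤ ρ := zero_le_one.trans hρ
  calc ∑ k ∈ Finset.range n, ρ ^ k * ∑ l ∈ Finset.Ico (k - τ) k, q l
      ≤ ∑ k ∈ Finset.range n, ∑ l ∈ Finset.Ico (k - τ) k, ρ ^ n * (ρ ^ l * q l) := by
        refine Finset.sum_le_sum fun k hk => ?_
        rw [Finset.mul_sum]
        refine Finset.sum_le_sum fun l _ => ?_
        have h1 : ρ ^ k ≤ ρ ^ n := pow_le_pow_right₀ hρ (Finset.mem_range.1 hk).le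
        have h2 : q l ≤ ρ ^ l * q l := le_mul_of_one_le_left (hq l) (one_le_pow₀ hρ)
        exact mul_le_mul h1 h2 (hq l) (by positivity)
    _ = ∑ l ∈ Finset.range n, ∑ k ∈ Finset.range n with l < k ∧ k ≤ l + τ,
          ρ ^ n * (ρ ^ l * q l) := by
        refine Finset.sum_comm' fun k l => ?_
        simp only [Finset.mem_range, Finset.mem_Ico, Finset.mem_filter]
        omega
    _ ≤ ∑ l ∈ Finset.range n, τ * (ρ ^ n * (ρ ^ l * q l)) := by
        refine Finset.sum_le_sum fun l _ => ?_
        rw [Finset.sum_const, nsmul_eq_mul]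
        have hcard : (Finset.range n |>.filter fun k => l < k ∧ k ≤ l + τ).card ≤ τ := by
          refine (Finset.card_le_card (t := Finset.Ioc l (l + τ)) fun k hk => ?_).trans_eq (by simp)
          simp only [Finset.mem_filter] at hk
          exact Finset.mem_Ioc.2 hk.2
        have : 0 ≤ ρ ^ n * (ρ ^ l * q l) := by have := hq l; positivity
        gcongr
    _ = _ := by
        simp only [Finset.mul_sum, mul_assoc]

/-- One epoch: weighted summation of the expected one-step inequalities. -/
theorem epoch_sum_le {n τ : ℕ} {L γ κ a ρ pt : ℝ} {p R q : ℕ → ℝ} (hL : 0 ≤ L) (hγ : 0 < γ)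
    (hρ : 1 ≤ ρ) (hstep : 4 * γ * L + 8 * γ * L * (τ : ℝ) ^ 2 * ρ ^ n ≤ 1) (hq : ∀ k, 0 ≤ q k)
    (h : ∀ k < n, p (k + 1) ≤ 1 / 2 * pt + a * p k + κ * (R k - ρ * R (k + 1))
      + (2 * L - 1 / (2 * γ)) * q k + 4 * L * τ * ∑ l ∈ Finset.Ico (k - τ) k, q l) :
    a * ρ ^ n * p n + (1 - a * ρ) * ∑ k ∈ Finset.range n, ρ ^ k * p (k + 1) + κ * (ρ ^ n * R n)
      ≤ 1 / 2 * (∑ k ∈ Finset.range n, ρ ^ k) * pt + a * p 0 + κ * R 0 := by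
  have hρ0 : 0 ≤ ρ := zero_le_one.trans hρ
  have h1 : ∑ k ∈ Finset.range n, ρ ^ k * p (k + 1)
      ≤ ∑ k ∈ Finset.range n, (1 / 2 * ρ ^ k * pt + a * (ρ ^ k * p k)
        + κ * (ρ ^ k * R k - ρ ^ (k + 1) * R (k + 1))
        + (2 * L - 1 / (2 * γ)) * (ρ ^ k * q k)
        + 4 * L * τ * (ρ ^ k * ∑ l ∈ Finset.Ico (k - τ) k, q l)) := by
    refine Finset.sum_le_sum fun k hk => ?_
    refine (mul_le_mul_of_nonneg_left (h k (Finset.mem_range.1 hk))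
      (pow_nonneg hρ0 k)).trans_eq ?_
    ring
  simp only [Finset.sum_add_distrib, ← Finset.mul_sum, ← Finset.sum_mul] at h1
  rw [Finset.sum_range_sub' (fun k => ρ ^ k * R k)] at h1
  have h2 : ∑ k ∈ Finset.range n, ρ ^ k * p k
      = p 0 + ρ * (∑ k ∈ Finset.range n, ρ ^ k * p (k + 1)) - ρ ^ n * p n := by
    have h3 := Finset.sum_range_succ (fun k => ρ ^ k * p k) n
    rw [Finset.sum_range_succ'] at h3
    simp only [pow_zero, one_mul, pow_succ' ρ, mul_assoc, ← Finset.mul_sum] at h3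
    linarith
  have h4 := mul_le_mul_of_nonneg_left (sum_delay_window_le hq hρ n τ)
    (by positivity : 0 ≤ 4 * L * (τ : ℝ))
  have hQ : 0 ≤ ∑ k ∈ Finset.range n, ρ ^ k * q k :=
    Finset.sum_nonneg fun k _ => mul_nonneg (pow_nonneg hρ0 k) (hq k)
  -- The total coefficient of the weighted increments, curvature and delay against the proximal
  -- gain, is `hstep` divided by `2γ`.
  have h5 : 2 * L - 1 / (2 * γ) + 4 * L * τ * (τ * ρ ^ n) ≤ 0 := by
    have h6 : (4 * γ * L + 8 * γ * L * (τ : ℝ) ^ 2 * ρ ^ n - 1) / (2 * γ) ≤ 0 :=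
      div_nonpos_of_nonpos_of_nonneg (by linarith) (by positivity)
    refine le_trans (le_of_eq ?_) h6
    field_simp
    ring
  have h7 := mul_nonpos_of_nonpos_of_nonneg h5 hQ
  rw [h2] at h1
  simp only [pow_zero, one_mul] at h1
  linear_combination h1 + h4 + h7

/-- Chaining the epochs for `θ₁ s = 2 / (s + 4)`. -/
theorem chain_convex {n : ℕ} {γ P₀ R₀ : ℝ} {θ e T r : ℕ → ℝ}
    (hθ : ∀ s : ℕ, θ s = 2 / ((s : ℝ) + 4)) (he : ∀ s, 0 ≤ e s) (hT : ∀ s, e s ≤ T s)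
    (h0 : aCoef (θ 0) * e 0 + (1 - aCoef (θ 0)) * T 0 + θ 0 ^ 2 / (2 * γ) * r 0
      ≤ 1 / 2 * n * P₀ + aCoef (θ 0) * P₀ + θ 0 ^ 2 / (2 * γ) * R₀)
    (h : ∀ s, aCoef (θ (s + 1)) * e (s + 1) + (1 - aCoef (θ (s + 1))) * T (s + 1)
        + θ (s + 1) ^ 2 / (2 * γ) * r (s + 1)
      ≤ 1 / 2 * T s + aCoef (θ (s + 1)) * e s + θ (s + 1) ^ 2 / (2 * γ) * r s) (S : ℕ) :
    e S + (1 / 2 + θ S) * (T S - e S) + θ S ^ 2 / (2 * γ) * r S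
      ≤ 2 * n * θ S ^ 2 * P₀ + θ S ^ 2 / (2 * γ) * R₀ := by
  induction S with
  | zero =>
    -- Here `a = 0`, so the momentum term disappears and `2 n θ² = n / 2`.
    have h1 : θ 0 = 1 / 2 := by rw [hθ]; norm_num
    simp only [h1, aCoef] at h0 ⊢
    linarith
  | succ s ih =>
    have hs := h s
    have hc : (0 : ℝ) ≤ s := Nat.cast_nonneg s
    have hθs : 0 < θ s := by rw [hθ]; positivity
    -- The induction hypothesis is multiplied by `c`, which matches the distance terms. On the right
    -- of `hs`, `e s` and `T s - e s` then have coefficients `1/2 + a = 1 - θ (s + 1)` and `1/2`;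
    -- `h1` and `h2` bound them by `c` and `c (1/2 + θ s)`.
    set c := θ (s + 1) ^ 2 / θ s ^ 2 with hcdef
    have hc0 : 0 ≤ c := by positivity
    have hcθ : c * θ s ^ 2 = θ (s + 1) ^ 2 := by rw [hcdef]; field_simp
    have hcval : c = ((s : ℝ) + 4) ^ 2 / ((s : ℝ) + 5) ^ 2 := by
      rw [hcdef, hθ, hθ]
      push_cast
      field_simp
      ring
    have h1 : 1 / 2 + aCoef (θ (s + 1)) ≤ c := by
      rw [hcval, aCoef, hθ]
      push_cast
      rw [le_div_iff₀ (by positivity)]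
      field_simp
      nlinarith
    have h2 : 1 / 2 ≤ c * (1 / 2 + θ s) := by
      rw [hcval, hθ, div_mul_eq_mul_div, le_div_iff₀ (by positivity)]
      field_simp
      nlinarith
    have h3 := mul_le_mul_of_nonneg_left ih hc0
    have h4 := mul_le_mul_of_nonneg_right h1 (he s)
    have h5 := mul_le_mul_of_nonneg_right h2 (sub_nonneg.2 (hT s))
    rw [← hcθ] at hs ⊢
    have h6 : 1 - aCoef (θ (s + 1)) = 1 / 2 + θ (s + 1) := by rw [aCoef]; ring
    have h7 : aCoef (θ (s + 1)) = 1 / 2 - θ (s + 1) := by rw [aCoef]; ring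
    rw [h6] at hs
    rw [h7] at hs h4
    linear_combination hs + h3 + h4 + h5

/-- Chaining the epochs with geometric decay. -/
theorem chain_strongly_convex {n : ℕ} (hn : 0 < n) {γ P₀ R₀ θ ρ W : ℝ} {e T r pt : ℕ → ℝ}
    (hγ : 0 < γ) (hθ0 : 0 < θ) (hθ : θ ≤ 1 / 2) (hρ : 1 ≤ ρ)
    (hρn : 1 / 2 * ρ ^ n ≤ 1 - aCoef θ * ρ) (hW : n ≤ W) (hP₀ : 0 ≤ P₀) (hR₀ : 0 ≤ R₀)
    (hT : ∀ s, 0 ≤ T s) (he : ∀ s, 0 ≤ e s) (hr : ∀ s, 0 ≤ r s)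
    (he0 : e 0 = P₀) (hr0 : r 0 = R₀) (hpt0 : pt 0 = P₀) (hpt : ∀ s, W * pt (s + 1) ≤ T s)
    (h : ∀ s, aCoef θ * ρ ^ n * e (s + 1) + (1 - aCoef θ * ρ) * T s
        + θ ^ 2 / (2 * γ) * (ρ ^ n * r (s + 1))
      ≤ 1 / 2 * W * pt s + aCoef θ * e s + θ ^ 2 / (2 * γ) * r s) (S : ℕ) :
    pt (S + 1) ≤ (ρ ^ (S * n))⁻¹ * ((1 + 1 / (n : ℝ)) * P₀ + 1 / (4 * n * γ) * R₀) := by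
  have hn' : (0 : ℝ) < n := by exact_mod_cast hn
  have hρ0 : 0 < ρ := zero_lt_one.trans_le hρ
  have ha : 0 ≤ aCoef θ := by rw [aCoef]; linarith
  have hW0 : 0 < W := hn'.trans_le hW
  -- This potential shrinks by `ρ ^ n` per epoch, thanks to `hρn`.
  have hΦ : ∀ s, ρ ^ (s * n) * (1 / 2 * W * pt s + aCoef θ * e s + θ ^ 2 / (2 * γ) * r s)
      ≤ 1 / 2 * W * P₀ + aCoef θ * P₀ + θ ^ 2 / (2 * γ) * R₀ := by
    intro s
    induction s with
    | zero => simp [he0, hr0, hpt0]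
    | succ s ih =>
      have h1 : ρ ^ n * (1 / 2 * W * pt (s + 1) + aCoef θ * e (s + 1)
          + θ ^ 2 / (2 * γ) * r (s + 1)) ≤ 1 / 2 * W * pt s + aCoef θ * e s
          + θ ^ 2 / (2 * γ) * r s := by
        have h2 := mul_le_mul_of_nonneg_left (hpt s) (by positivity : 0 ≤ 1 / 2 * ρ ^ n)
        have h3 := mul_le_mul_of_nonneg_right hρn (hT s)
        linear_combination h s + h2 + h3
      have h4 := mul_le_mul_of_nonneg_left h1 (by positivity : 0 ≤ ρ ^ (s * n))
      rw [← mul_assoc, ← pow_add, ← Nat.succ_mul] at h4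
      exact h4.trans ih
  have h1 := hΦ S
  -- The last epoch is used without its contraction, so the exponent is `S * n`.
  have h2 : 1 / 2 * W * pt (S + 1) ≤ 1 / 2 * W * pt S + aCoef θ * e S + θ ^ 2 / (2 * γ) * r S := by
    have h3 : 1 / 2 ≤ 1 - aCoef θ * ρ := by
      have := one_le_pow₀ hρ (n := n)
      linarith
    have h4 := mul_le_mul_of_nonneg_right h3 (hT S)
    have h5 : 0 ≤ aCoef θ * ρ ^ n * e (S + 1) := by have := he (S + 1); positivity
    have h6 : 0 ≤ θ ^ 2 / (2 * γ) * (ρ ^ n * r (S + 1)) := by have := hr (S + 1); positivity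
    linarith [h S, hpt S]
  rw [inv_mul_eq_div, le_div_iff₀ (by positivity)]
  have h3 : ρ ^ (S * n) * (1 / 2 * W * pt (S + 1))
      ≤ 1 / 2 * W * P₀ + aCoef θ * P₀ + θ ^ 2 / (2 * γ) * R₀ :=
    (mul_le_mul_of_nonneg_left h2 (by positivity)).trans h1
  have h4 : aCoef θ * P₀ ≤ 1 / 2 * W * (1 / n * P₀) := by
    have h5 : (1 : ℝ) ≤ W * (1 / n) := by
      rw [mul_one_div, le_div_iff₀ hn']; linarith
    have h6 : aCoef θ ≤ 1 / 2 := by rw [aCoef]; linarith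
    nlinarith [mul_le_mul_of_nonneg_right h5 hP₀, mul_le_mul_of_nonneg_right h6 hP₀]
  have h5 : θ ^ 2 / (2 * γ) * R₀ ≤ 1 / 2 * W * (1 / (4 * n * γ) * R₀) := by
    rw [← mul_assoc]
    refine mul_le_mul_of_nonneg_right ?_ hR₀
    have h6 : θ ^ 2 ≤ 1 / 4 := by nlinarith
    calc θ ^ 2 / (2 * γ) ≤ 1 / 4 / (2 * γ) := by gcongr
      _ = 1 / 2 * n * (1 / (4 * n * γ)) := by field_simp
      _ ≤ _ := by gcongr
  have h6 : 1 / 2 * W * (pt (S + 1) * ρ ^ (S * n))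
      ≤ 1 / 2 * W * ((1 + 1 / (n : ℝ)) * P₀ + 1 / (4 * n * γ) * R₀) := by
    linear_combination h3 + h4 + h5
  exact le_of_mul_le_mul_left h6 (by positivity)

/-- The parameter choice of the strongly convex case satisfies the step size conditions. -/
theorem strongly_convex_parameters {n τ : ℕ} (hn : 0 < n) {L γ μ θ ρ : ℝ} (hL : 0 < L)
    (hγ : 0 < γ) (hμ : 0 < μ) (hμL : μ ≤ L * (τ : ℝ) ^ 2 / (4 * n))
    (hstep : 5 * γ * L + 95 / 8 * (τ : ℝ) ^ 2 * γ * L ≤ 1)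
    (hθ : θ = 1 / (τ : ℝ) * √(n * μ / L)) (hρ : ρ = 1 + μ * γ / θ) :
    0 < θ ∧ θ ≤ 1 / 2 ∧ 1 ≤ ρ ∧ 4 * γ * L + 8 * γ * L * (τ : ℝ) ^ 2 * ρ ^ n ≤ 1 ∧
      1 / 2 * ρ ^ n ≤ 1 - aCoef θ * ρ := by
  have hn' : (1 : ℝ) ≤ n := by exact_mod_cast hn
  have hn0 : (0 : ℝ) < n := by linarith
  have hτ : (0 : ℝ) < τ := by
    rcases Nat.eq_zero_or_pos τ with h0 | h0
    · rw [h0] at hμL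
      simp at hμL
      linarith
    · exact_mod_cast h0
  have hθ0 : 0 < θ := by rw [hθ]; positivity
  have hθsq : θ ^ 2 * τ ^ 2 * L = n * μ := by
    rw [hθ, mul_pow, Real.sq_sqrt (by positivity)]
    field_simp
  have hθ2 : θ ≤ 1 / 2 := by
    rw [le_div_iff₀ (by positivity)] at hμL
    have h1 : θ ^ 2 * (τ ^ 2 * L) ≤ 1 / 4 * (τ ^ 2 * L) := by linarith
    have h2 := le_of_mul_le_mul_right h1 (by positivity)
    nlinarith
  set b := γ * L * (τ : ℝ) ^ 2 with hb
  have hb0 : 0 < b := by positivity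
  have hγL : 0 < γ * L := by positivity
  have hb1 : 95 / 8 * b ≤ 1 - 5 * (γ * L) := by rw [hb]; linarith
  set ε := μ * γ / θ with hε
  have hε0 : 0 < ε := by positivity
  -- The choice of `θ` means `θ² τ² L = n μ`, which makes the growth exponent over an epoch `θ b`, a
  -- small quantity.
  have hnε : n * ε = θ * b := by
    rw [hε, hb]
    field_simp
    linarith
  have hθb : θ * b ≤ 1 / 2 * b := mul_le_mul_of_nonneg_right hθ2 hb0.le
  have hρn : ρ ^ n ≤ 1 + 2 * (θ * b) := by
    have h1 : ρ ^ n ≤ Real.exp (n * ε) := by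
      rw [Real.exp_nat_mul]
      refine pow_le_pow_left₀ (by rw [hρ]; positivity) ?_ n
      rw [hρ, add_comm]
      exact Real.add_one_le_exp ε
    have h2 := Real.exp_bound_div_one_sub_of_interval (x := n * ε) (by positivity)
      (by rw [hnε]; linarith)
    refine h1.trans (h2.trans ?_)
    rw [hnε, div_le_iff₀ (by linarith)]
    nlinarith [mul_pos hθ0 hb0]
  refine ⟨hθ0, hθ2, by rw [hρ]; linarith, ?_, ?_⟩
  · have h1 : b * ρ ^ n ≤ b * (1 + 2 * (θ * b)) := mul_le_mul_of_nonneg_left hρn hb0.le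
    -- `95/64` is the value for which `8 * (95/64)` equals the `95/8` in the step size condition;
    -- the actual growth is well below it.
    have h2 : b * (1 + 2 * (θ * b)) ≤ b * (95 / 64) := by
      refine mul_le_mul_of_nonneg_left ?_ hb0.le
      linarith
    rw [show 8 * γ * L * (τ : ℝ) ^ 2 * ρ ^ n = 8 * (b * ρ ^ n) by rw [hb]; ring]
    linarith
  · have h1 : ε ≤ θ * b := by rw [← hnε]; exact le_mul_of_one_le_left hε0.le hn'
    have h2 : θ * b ≤ θ * (1 / 2) := mul_le_mul_of_nonneg_left (by linarith) hθ0.le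
    rw [hρ] at hρn ⊢
    rw [aCoef]
    nlinarith [mul_pos hθ0 hε0]

end RealSequences

/-! ### The error of the compensated delayed point. -/

section Compensation

variable {d n : ℕ} {θ : ℝ} {x z : ℕ → E d} {xt : E d}

theorem momentum_eq (hx : ∀ k < n, x (k + 1) = θ • z (k + 1) + (1 / 2 : ℝ) • xt + aCoef θ • x k)
    {k : ℕ} (hk : k ≤ n) : momentum θ x z xt k = extrap θ (z k) xt (x k) - x k := by
  cases k with
  | zero => simp [momentum]
  | succ k =>
    have h := hx k hk
    rw [momentum, if_neg (Nat.succ_ne_zero k), Nat.add_sub_cancel, extrap]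
    have h1 : θ • z (k + 1) + (1 / 2 : ℝ) • xt = x (k + 1) - aCoef θ • x k := by
      rw [h]; abel
    rw [h1]
    module

/-- The gap between the extrapolation point and the compensated point only involves the increments
made since the delayed state. -/
theorem extrap_sub_compensated
    (hx : ∀ k < n, x (k + 1) = θ • z (k + 1) + (1 / 2 : ℝ) • xt + aCoef θ • x k)
    (ha : aCoef θ ≠ 1) {j k : ℕ} (hjk : j ≤ k) (hk : k ≤ n) :
    extrap θ (z k) xt (x k) - compensated θ x z xt j k
      = ∑ l ∈ Finset.Ico j k,
          ((1 - aCoef θ ^ (k - l + 1)) / (1 - aCoef θ)) • θ • (z (l + 1) - z l) := by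
  have ha' : 1 - aCoef θ ≠ 0 := sub_ne_zero.2 ha.symm
  have h0 : compensated θ x z xt k k = extrap θ (z k) xt (x k) := by
    rw [compensated, momentum_eq hx hk]
    simp [div_self ha']
  -- Telescope in the delayed state `l` with `k` fixed; at `l = k` the compensated point is the
  -- extrapolation point itself.
  rw [← h0, ← Finset.sum_Ico_sub (fun l => compensated θ x z xt l k) hjk]
  refine Finset.sum_congr rfl fun l hl => ?_
  obtain ⟨-, hlk⟩ := Finset.mem_Ico.1 hl
  have hln : l < n := hlk.trans_le hk
  obtain ⟨t, rfl⟩ : ∃ t, k = l + 1 + t := ⟨k - (l + 1), by omega⟩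
  have e1 : l + 1 + t - (l + 1) + 1 = t + 1 := by omega
  have e2 : l + 1 + t - l + 1 = t + 2 := by omega
  have hm : momentum θ x z xt (l + 1) = aCoef θ • (x (l + 1) - x l) := by
    simp [momentum]
  have hv : θ • (z (l + 1) - z l) = x (l + 1) - x l - momentum θ x z xt l := by
    rw [momentum_eq hx hln.le, hx l hln, extrap]
    module
  -- The recursion of geometric sums gives `x (l + 1) - x l` and the momentum at `l` the same
  -- coefficient, leaving only `θ (z (l + 1) - z l)`.
  have hc : (1 - aCoef θ ^ (t + 2)) / (1 - aCoef θ)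
      = 1 + (1 - aCoef θ ^ (t + 1)) / (1 - aCoef θ) * aCoef θ := by
    field_simp
    ring
  simp only [compensated, e1, e2]
  rw [hm, hv, hc]
  module

/-- The geometric coefficients are at most `1 / (1 - a) ≤ 2`, and Cauchy–Schwarz over at most `τ`
terms costs a factor `τ`. The window is enlarged so that it no longer depends on the random delay.
-/
theorem norm_extrap_sub_compensated_sq_le
    (hx : ∀ k < n, x (k + 1) = θ • z (k + 1) + (1 / 2 : ℝ) • xt + aCoef θ • x k)
    (hθ0 : 0 < θ) (hθ : θ ≤ 1 / 2) {j k τ : ℕ} (hjk : j ≤ k) (hk : k ≤ n) (hτ : k ≤ j + τ) :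
    ‖extrap θ (z k) xt (x k) - compensated θ x z xt j k‖ ^ 2
      ≤ 4 * τ * ∑ l ∈ Finset.Ico (k - τ) k, ‖θ • (z (l + 1) - z l)‖ ^ 2 := by
  have ha0 : 0 ≤ aCoef θ := by rw [aCoef]; linarith
  have ha1 : 1 / 2 ≤ 1 - aCoef θ := by rw [aCoef]; linarith
  rw [extrap_sub_compensated hx (by linarith) hjk hk]
  have hc : ∀ t : ℕ, ‖(1 - aCoef θ ^ t) / (1 - aCoef θ)‖ ≤ 2 := fun t => by
    have h1 : aCoef θ ^ t ≤ 1 := pow_le_one₀ ha0 (by linarith)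
    have h2 : 0 ≤ aCoef θ ^ t := pow_nonneg ha0 t
    rw [Real.norm_of_nonneg (div_nonneg (by linarith) (by linarith)), div_le_iff₀ (by linarith)]
    linarith
  have h1 : ‖∑ l ∈ Finset.Ico j k,
      ((1 - aCoef θ ^ (k - l + 1)) / (1 - aCoef θ)) • θ • (z (l + 1) - z l)‖
      ≤ 2 * ∑ l ∈ Finset.Ico j k, ‖θ • (z (l + 1) - z l)‖ := by
    rw [Finset.mul_sum]
    refine (norm_sum_le _ _).trans (Finset.sum_le_sum fun l _ => ?_)
    rw [norm_smul]
    exact mul_le_mul_of_nonneg_right (hc _) (norm_nonneg _)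
  have h2 := sq_sum_le_card_mul_sum_sq (s := Finset.Ico j k)
    (f := fun l => ‖θ • (z (l + 1) - z l)‖)
  have h3 : ∑ l ∈ Finset.Ico j k, ‖θ • (z (l + 1) - z l)‖ ^ 2
      ≤ ∑ l ∈ Finset.Ico (k - τ) k, ‖θ • (z (l + 1) - z l)‖ ^ 2 :=
    Finset.sum_le_sum_of_subset_of_nonneg (Finset.Ico_subset_Ico_left (by omega))
      fun _ _ _ => sq_nonneg _
  have h4 : ((Finset.Ico j k).card : ℝ) ≤ τ := by
    rw [Nat.card_Ico]
    exact_mod_cast (by omega : k - j ≤ τ)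
  calc _ ≤ (2 * ∑ l ∈ Finset.Ico j k, ‖θ • (z (l + 1) - z l)‖) ^ 2 := by gcongr
    _ = 4 * (∑ l ∈ Finset.Ico j k, ‖θ • (z (l + 1) - z l)‖) ^ 2 := by ring
    _ ≤ 4 * (τ * ∑ l ∈ Finset.Ico (k - τ) k, ‖θ • (z (l + 1) - z l)‖ ^ 2) := by
      refine mul_le_mul_of_nonneg_left (h2.trans ?_) (by norm_num)
      gcongr
    _ = _ := by ring

end Compensation

/-! ### The pathwise one-step inequality. -/

section OneStep

variable {d n : ℕ} {f : Fin n → E d → ℝ} {h : E d → ℝ} {L γ μ θ : ℝ}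

/-- The part of the one-step bound whose mean over the sampled index `r` is nonpositive. -/
noncomputable def stepNoise (f : Fin n → E d → ℝ) (L θ : ℝ) (xstar w z xt : E d) (r : Fin n) : ℝ :=
  θ * inner ℝ (gradient (fAvg f) w - vrGrad f r w xt) (z - xstar)
    + 1 / (4 * L) * ‖gradient (fAvg f) w - vrGrad f r w xt‖ ^ 2 - 1 / 2 * bregman f w xt

/-- The linear term averages to zero by unbiasedness, and `1/(4L)` times the variance bound `2L` is
exactly the subtracted half divergence. -/
theorem sum_stepNoise_le_zero (hn : 0 < n) (hL : 0 < L) (hc : ∀ r, ConvexOn ℝ Set.univ (f r))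
    (hf : ∀ r, LSmooth L (f r)) (θ : ℝ) (xstar w z xt : E d) :
    ∑ r, stepNoise f L θ xstar w z xt r ≤ 0 := by
  simp only [stepNoise, Finset.sum_sub_distrib, Finset.sum_add_distrib, ← Finset.mul_sum,
    ← sum_inner, sum_gradient_sub_vrGrad hn (fun r => (hf r).1), inner_zero_left,
    Finset.sum_const, Finset.card_univ, Fintype.card_fin, nsmul_eq_mul]
  have h1 := mul_le_mul_of_nonneg_left (sum_norm_gradient_sub_vrGrad_sq_le hn hL hc hf w xt)
    (by positivity : 0 ≤ 1 / (4 * L))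
  have h2 : 1 / (4 * L) * (n * (2 * L * bregman f w xt)) = n * (1 / 2 * bregman f w xt) := by
    field_simp
    ring
  linarith

theorem map_three_le {g : E d → ℝ} (hg : ConvexOn ℝ Set.univ g) {a b c : ℝ} (ha : 0 ≤ a)
    (hb : 0 ≤ b) (hc : 0 ≤ c) (habc : a + b + c = 1) (u v w : E d) :
    g (a • u + b • v + c • w) ≤ a * g u + b * g v + c * g w := by
  have h1 := hg.map_sum_le (t := Finset.univ) (w := ![a, b, c]) (p := ![u, v, w])
    (by intro i _; fin_cases i <;> simpa) (by simp [Fin.sum_univ_three, habc])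
    (fun _ _ => Set.mem_univ _)
  simpa [Fin.sum_univ_three] using h1

/-- Convexity of `fAvg f` at `w` is used towards `x` and `x*` only; towards the snapshot the exact
Bregman divergence is kept in `stepNoise` to pay for the variance. -/
theorem one_step_le (hn : 0 < n) (hL : 0 < L) (hγ : 0 < γ) (hμ : 0 ≤ μ) (hθ0 : 0 < θ)
    (hθ : θ ≤ 1 / 2) (hc : ∀ r, ConvexOn ℝ Set.univ (f r)) (hf : ∀ r, LSmooth L (f r))
    (hh : StrongConvexOn Set.univ μ h) (xstar w x z z' xt : E d) (r : Fin n)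
    (hmin : IsMinOn (proxObjective h θ γ z (vrGrad f r w xt)) Set.univ (z' - z)) :
    objective f h (θ • z' + (1 / 2 : ℝ) • xt + aCoef θ • x) - objective f h xstar
      ≤ 1 / 2 * (objective f h xt - objective f h xstar)
        + aCoef θ * (objective f h x - objective f h xstar)
        + θ ^ 2 / (2 * γ) * (‖z - xstar‖ ^ 2 - (1 + μ * γ / θ) * ‖z' - xstar‖ ^ 2)
        + (2 * L - 1 / (2 * γ)) * ‖θ • (z' - z)‖ ^ 2 + L * ‖extrap θ z xt x - w‖ ^ 2
        + stepNoise f L θ xstar w z xt r := by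
  have ha : 0 ≤ aCoef θ := by rw [aCoef]; linarith
  have hsum : θ + 1 / 2 + aCoef θ = 1 := by rw [aCoef]; ring
  have hF := LSmooth.fAvg hn hf
  have hFc := convexOn_fAvg hc
  set G := gradient (fAvg f) w with hG
  set g := vrGrad f r w xt with hg
  set x' := θ • z' + (1 / 2 : ℝ) • xt + aCoef θ • x with hx'
  have hA := le_add_inner_gradient_add hF.1 hF.2 w x'
  have hB : ‖x' - w‖ ^ 2 ≤ 2 * ‖θ • (z' - z)‖ ^ 2 + 2 * ‖extrap θ z xt x - w‖ ^ 2 := by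
    have h1 : x' - w = θ • (z' - z) + (extrap θ z xt x - w) := by
      rw [hx', extrap]
      module
    have h2 := parallelogram_law_with_norm ℝ (θ • (z' - z)) (extrap θ z xt x - w)
    rw [← h1] at h2
    nlinarith [norm_nonneg (θ • (z' - z) - (extrap θ z xt x - w))]
  have hC : inner ℝ G (x' - w)
      = θ * inner ℝ G (z' - w) + 1 / 2 * inner ℝ G (xt - w) + aCoef θ * inner ℝ G (x - w) := by
    rw [← real_inner_smul_right, ← real_inner_smul_right, ← real_inner_smul_right,
      ← inner_add_right, ← inner_add_right]
    congr 1
    have h1 : x' - w = x' - (θ + 1 / 2 + aCoef θ) • w := by rw [hsum, one_smul]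
    rw [h1, hx']
    module
  have hD1 := mul_le_mul_of_nonneg_left (inner_gradient_le_sub hFc hF.1 w x) ha
  have hD2 := mul_le_mul_of_nonneg_left (inner_gradient_le_sub hFc hF.1 w xstar) hθ0.le
  -- `z'` depends on the sample, so the error `G - g` is split: its product with `z - xstar`
  -- averages to zero, and the one with `z' - z` goes to Young's inequality.
  have hE : inner ℝ G (z' - w) = inner ℝ G (xstar - w) + inner ℝ (G - g) (z - xstar)
      + inner ℝ (G - g) (z' - z) + (inner ℝ g (z' - z) - inner ℝ g (xstar - z)) := by
    simp only [inner_sub_left, inner_sub_right]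
    ring
  have hFv : θ * inner ℝ (G - g) (z' - z)
      ≤ 1 / (4 * L) * ‖G - g‖ ^ 2 + L * ‖θ • (z' - z)‖ ^ 2 := by
    rw [← real_inner_smul_right]
    refine (real_inner_le_norm _ _).trans ?_
    have h1 : 1 / (4 * L) * ‖G - g‖ ^ 2 + L * ‖θ • (z' - z)‖ ^ 2 - ‖G - g‖ * ‖θ • (z' - z)‖
        = 1 / (4 * L) * (‖G - g‖ - 2 * L * ‖θ • (z' - z)‖) ^ 2 := by
      field_simp
      ring
    have h2 : 0 ≤ 1 / (4 * L) * (‖G - g‖ - 2 * L * ‖θ • (z' - z)‖) ^ 2 := by positivity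
    linarith
  have hP := mul_le_mul_of_nonneg_left (proxObjective_growth hμ hθ0 hγ hh hmin (xstar - z)) hθ0.le
  have e1 : xstar - z - (z' - z) = -(z' - xstar) := by abel
  simp only [proxObjective, e1, norm_neg, add_sub_cancel, norm_sub_rev xstar z] at hP
  have hH := map_three_le (hh.mono hμ |> strongConvexOn_zero.1) hθ0.le (by norm_num : (0:ℝ) ≤ 1 / 2)
    ha hsum z' xt x
  rw [← hx'] at hH
  have hv : θ * (θ / (2 * γ) * ‖z' - z‖ ^ 2) = 1 / (2 * γ) * ‖θ • (z' - z)‖ ^ 2 := by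
    rw [norm_smul, mul_pow, Real.norm_eq_abs, sq_abs]
    ring
  have hρ : θ ^ 2 / (2 * γ) * ((1 + μ * γ / θ) * ‖z' - xstar‖ ^ 2)
      = θ * ((θ / (2 * γ) + μ / 2) * ‖z' - xstar‖ ^ 2) := by
    field_simp
  have hB' := mul_le_mul_of_nonneg_left hB (by positivity : 0 ≤ L / 2)
  have haval : aCoef θ = 1 / 2 - θ := by rw [aCoef]; ring
  rw [hC, hE] at hA
  simp only [objective, stepNoise, bregman, ← hG, ← hg]
  rw [haval] at hA hD1 hH ⊢
  linear_combination hA + hB' + hD1 + hD2 + hFv + hP + hH - hv + hρ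

end OneStep

/-- A run of the method under asynchronous sampling, with `h` convex of modulus `μ ≥ 0` and with
the snapshot weights `ρ = 1 + μ γ / θ₁`. -/
structure AsyncRun {d n : ℕ} (τ : ℕ) (f : Fin n → E d → ℝ) (h : E d → ℝ) (L γ μ ρ : ℝ) (θ : ℕ → ℝ)
    (x₀ xstar : E d) {Ω : Type*} {mΩ : MeasurableSpace Ω} (P : Measure Ω) (ℱ : Filtration ℕ mΩ)
    (i : ℕ → ℕ → Ω → Fin n) (j : ℕ → ℕ → Ω → ℕ)
    (x z : Ω → ℕ → ℕ → E d) (xt : Ω → ℕ → E d) : Prop where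
  n_pos : 0 < n
  L_pos : 0 < L
  γ_pos : 0 < γ
  μ_nonneg : 0 ≤ μ
  f_convex : ∀ r, ConvexOn ℝ Set.univ (f r)
  f_smooth : ∀ r, LSmooth L (f r)
  h_convex : StrongConvexOn Set.univ μ h
  isMinOn : IsMinOn (objective f h) Set.univ xstar
  sampling : AsyncSampling P ℱ n τ i j
  θ_pos : ∀ s, 0 < θ s
  θ_le : ∀ s, θ s ≤ 1 / 2
  ρ_eq : ∀ s, ρ = 1 + μ * γ / θ s
  isRun : ∀ ω, IsRun f h γ θ ρ x₀ (fun s k => i s k ω) (fun s k => j s k ω) (x ω) (z ω) (xt ω)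

/-! ### Adaptedness of the iterates. -/

namespace AsyncRun

variable {d n τ : ℕ} {f : Fin n → E d → ℝ} {h : E d → ℝ} {L γ μ ρ : ℝ} {θ : ℕ → ℝ}
  {x₀ xstar : E d} {Ω : Type*} {mΩ : MeasurableSpace Ω} {P : Measure Ω} {ℱ : Filtration ℕ mΩ}
  {i : ℕ → ℕ → Ω → Fin n} {j : ℕ → ℕ → Ω → ℕ} {x z : Ω → ℕ → ℕ → E d} {xt : Ω → ℕ → E d}

theorem convexOn_h (H : AsyncRun τ f h L γ μ ρ θ x₀ xstar P ℱ i j x z xt) :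
    ConvexOn ℝ Set.univ h :=
  strongConvexOn_zero.1 (H.h_convex.mono H.μ_nonneg)

theorem one_le_ρ (H : AsyncRun τ f h L γ μ ρ θ x₀ xstar P ℱ i j x z xt) : 1 ≤ ρ := by
  have h1 := H.θ_pos 0
  have h2 := H.γ_pos
  have h3 := H.μ_nonneg
  rw [H.ρ_eq 0]
  have : 0 ≤ μ * γ / θ 0 := by positivity
  linarith

theorem finiteMeas_index (H : AsyncRun τ f h L γ μ ρ θ x₀ xstar P ℱ i j x z xt) (s : ℕ) {k : ℕ}
    (hk : k < n) : FiniteMeas (ℱ (s * n + k + 1)) (i s k) :=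
  ⟨Set.toFinite _, fun c => H.sampling.i_meas s k hk (measurableSet_singleton c)⟩

theorem finiteMeas_delay (H : AsyncRun τ f h L γ μ ρ θ x₀ xstar P ℱ i j x z xt) (s : ℕ) {k : ℕ}
    (hk : k < n) : FiniteMeas (ℱ (s * n + k)) (j s k) := by
  refine ⟨(Set.finite_Iic k).subset ?_, fun c =>
    H.sampling.j_meas s k hk (measurableSet_singleton c)⟩
  rintro _ ⟨ω, rfl⟩
  exact H.sampling.j_le s k hk ω

/-- The compensated point used at inner iteration `k` of epoch `s`. -/
noncomputable def delayedPoint (θ : ℕ → ℝ) (j : ℕ → ℕ → Ω → ℕ) (x z : Ω → ℕ → ℕ → E d)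
    (xt : Ω → ℕ → E d) (s k : ℕ) (ω : Ω) : E d :=
  compensated (θ s) (x ω s) (z ω s) (xt ω s) (j s k ω) k

theorem finiteMeas_delayedPoint (H : AsyncRun τ f h L γ μ ρ θ x₀ xstar P ℱ i j x z xt) {s k : ℕ}
    (hk : k < n) (hx : ∀ l ≤ k, FiniteMeas (ℱ (s * n + k)) fun ω => x ω s l)
    (hz : ∀ l ≤ k, FiniteMeas (ℱ (s * n + k)) fun ω => z ω s l)
    (hxt : FiniteMeas (ℱ (s * n + k)) fun ω => xt ω s) :
    FiniteMeas (ℱ (s * n + k)) (delayedPoint θ j x z xt s k) := by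
  refine (H.finiteMeas_delay s hk).bind
    (G := fun l ω => compensated (θ s) (x ω s) (z ω s) (xt ω s) l k) ?_
  rintro _ ⟨ω₀, rfl⟩
  have hl := H.sampling.j_le s k hk ω₀
  generalize j s k ω₀ = l at hl
  have hm : FiniteMeas (ℱ (s * n + k)) fun ω => momentum (θ s) (x ω s) (z ω s) (xt ω s) l := by
    unfold momentum
    split_ifs with h0
    · exact ((hz 0 (by omega)).map₂ ((hx 0 (by omega)).map₂ hxt Prod.mk)
        fun a b => extrap (θ s) a b.2 b.1 - b.1)
    · exact (hx l hl).map₂ (hx (l - 1) (by omega)) fun a b => aCoef (θ s) • (a - b)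
  exact (hx l hl).map₂ hm
    fun a b => a + ((1 - aCoef (θ s) ^ (k - l + 1)) / (1 - aCoef (θ s))) • b

open Classical in
/-- A minimizer of the proximal objective, when there is one. -/
noncomputable def proxStep (h : E d → ℝ) (θ γ : ℝ) (z g : E d) : E d :=
  if hex : ∃ δ, IsMinOn (proxObjective h θ γ z g) Set.univ δ then hex.choose else 0

/-- Uniqueness makes the increment a function of `z` and `g`, so it inherits finiteness and
adaptedness from them; along a run the default value is never taken. -/
theorem eq_proxStep {θ₁ : ℝ} (hθ : 0 < θ₁) (hγ : 0 < γ) (hh : ConvexOn ℝ Set.univ h)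
    {z g δ : E d} (hmin : IsMinOn (proxObjective h θ₁ γ z g) Set.univ δ) :
    δ = proxStep h θ₁ γ z g := by
  have hex : ∃ δ, IsMinOn (proxObjective h θ₁ γ z g) Set.univ δ := ⟨δ, hmin⟩
  rw [proxStep, dif_pos hex]
  exact proxObjective_minimizer_unique hθ hγ hh hmin hex.choose_spec

theorem finiteMeas_epoch (H : AsyncRun τ f h L γ μ ρ θ x₀ xstar P ℱ i j x z xt) {s : ℕ}
    (hx : FiniteMeas (ℱ (s * n)) fun ω => x ω s 0) (hz : FiniteMeas (ℱ (s * n)) fun ω => z ω s 0)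
    (hxt : FiniteMeas (ℱ (s * n)) fun ω => xt ω s) {k : ℕ} (hk : k ≤ n) :
    ∀ l ≤ k, FiniteMeas (ℱ (s * n + k)) (fun ω => x ω s l) ∧
      FiniteMeas (ℱ (s * n + k)) (fun ω => z ω s l) := by
  induction k with
  | zero =>
    intro l hl
    obtain rfl : l = 0 := by omega
    exact ⟨hx, hz⟩
  | succ k ih =>
    have ihk := ih (by omega)
    have hkn : k < n := hk
    have hmono : ℱ (s * n + k) ≤ ℱ (s * n + (k + 1)) := ℱ.mono (by omega)
    intro l hl
    rcases Nat.lt_or_ge l (k + 1) with hlk | hlk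
    · exact ⟨((ihk l (by omega)).1).mono hmono, ((ihk l (by omega)).2).mono hmono⟩
    obtain rfl : l = k + 1 := by omega
    have hxtk : FiniteMeas (ℱ (s * n + k)) fun ω => xt ω s := hxt.mono (ℱ.mono (by omega))
    have hw := H.finiteMeas_delayedPoint hkn (fun l hl => (ihk l hl).1) (fun l hl => (ihk l hl).2)
      hxtk
    -- The delayed point is known at time `k`; only the sampled index needs the next σ-algebra.
    have hg : FiniteMeas (ℱ (s * n + (k + 1))) fun ω =>
        vrGrad f (i s k ω) (delayedPoint θ j x z xt s k ω) (xt ω s) :=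
      (H.finiteMeas_index s hkn).bind (G := fun r ω =>
        vrGrad f r (delayedPoint θ j x z xt s k ω) (xt ω s))
        fun r _ => (hw.map₂ hxtk fun a b => vrGrad f r a b).mono hmono
    have hz' : FiniteMeas (ℱ (s * n + (k + 1))) fun ω => z ω s (k + 1) := by
      have h1 : (fun ω => z ω s (k + 1)) = fun ω => z ω s k + proxStep h (θ s) γ (z ω s k)
          (vrGrad f (i s k ω) (delayedPoint θ j x z xt s k ω) (xt ω s)) := by
        funext ω
        rw [delayedPoint, ← eq_proxStep (H.θ_pos s) H.γ_pos H.convexOn_h ((H.isRun ω).z_step s k hkn)]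
        abel
      rw [h1]
      exact ((ihk k le_rfl).2.mono hmono).map₂ hg fun a b => a + proxStep h (θ s) γ a b
    refine ⟨?_, hz'⟩
    simp only [fun ω => (H.isRun ω).x_step s k hkn]
    exact hz'.map₂ ((hxtk.mono hmono).map₂ ((ihk k le_rfl).1.mono hmono) Prod.mk)
      fun a b => θ s • a + (1 / 2 : ℝ) • b.1 + aCoef (θ s) • b.2

theorem finiteMeas_start (H : AsyncRun τ f h L γ μ ρ θ x₀ xstar P ℱ i j x z xt) (s : ℕ) :
    FiniteMeas (ℱ (s * n)) (fun ω => x ω s 0) ∧ FiniteMeas (ℱ (s * n)) (fun ω => z ω s 0) ∧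
      FiniteMeas (ℱ (s * n)) (fun ω => xt ω s) := by
  induction s with
  | zero =>
    simp only [fun ω => (H.isRun ω).x_init, fun ω => (H.isRun ω).z_init,
      fun ω => (H.isRun ω).xt_init]
    exact ⟨finiteMeas_const _, finiteMeas_const _, finiteMeas_const _⟩
  | succ s ih =>
    have h1 := H.finiteMeas_epoch ih.1 ih.2.1 ih.2.2 le_rfl
    rw [Nat.succ_mul]
    simp only [fun ω => (H.isRun ω).x_sync s, fun ω => (H.isRun ω).z_sync s,
      fun ω => (H.isRun ω).xt_sync s]
    refine ⟨(h1 n le_rfl).1, (h1 n le_rfl).2, ?_⟩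
    exact (finiteMeas_sum (Finset.range n) fun k hk =>
      (h1 (k + 1) (Finset.mem_range.1 hk)).1.map fun a => ρ ^ k • a).map _

theorem finiteMeas_x (H : AsyncRun τ f h L γ μ ρ θ x₀ xstar P ℱ i j x z xt) (s : ℕ) {l k : ℕ}
    (hl : l ≤ k) (hk : k ≤ n) : FiniteMeas (ℱ (s * n + k)) (fun ω => x ω s l) :=
  have h1 := H.finiteMeas_start s
  (H.finiteMeas_epoch h1.1 h1.2.1 h1.2.2 hk l hl).1

theorem finiteMeas_z (H : AsyncRun τ f h L γ μ ρ θ x₀ xstar P ℱ i j x z xt) (s : ℕ) {l k : ℕ}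
    (hl : l ≤ k) (hk : k ≤ n) : FiniteMeas (ℱ (s * n + k)) (fun ω => z ω s l) :=
  have h1 := H.finiteMeas_start s
  (H.finiteMeas_epoch h1.1 h1.2.1 h1.2.2 hk l hl).2

theorem finiteMeas_xt (H : AsyncRun τ f h L γ μ ρ θ x₀ xstar P ℱ i j x z xt) (s k : ℕ) :
    FiniteMeas (ℱ (s * n + k)) (fun ω => xt ω s) :=
  (H.finiteMeas_start s).2.2.mono (ℱ.mono (by omega))

theorem objective_sub_nonneg (H : AsyncRun τ f h L γ μ ρ θ x₀ xstar P ℱ i j x z xt) (y : E d) :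
    0 ≤ objective f h y - objective f h xstar :=
  sub_nonneg.2 (isMinOn_univ_iff.1 H.isMinOn y)

/-! ### Integrability and inequalities in expectation. -/

variable [IsProbabilityMeasure P]

theorem integrable_x (H : AsyncRun τ f h L γ μ ρ θ x₀ xstar P ℱ i j x z xt) (s : ℕ) {k : ℕ}
    (hk : k ≤ n) (φ : E d → ℝ) : Integrable (fun ω => φ (x ω s k)) P :=
  ((H.finiteMeas_x s le_rfl hk).map φ).integrable (ℱ.le _) P

theorem integrable_z (H : AsyncRun τ f h L γ μ ρ θ x₀ xstar P ℱ i j x z xt) (s : ℕ) {k : ℕ}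
    (hk : k ≤ n) (φ : E d → ℝ) : Integrable (fun ω => φ (z ω s k)) P :=
  ((H.finiteMeas_z s le_rfl hk).map φ).integrable (ℱ.le _) P

theorem integrable_xt (H : AsyncRun τ f h L γ μ ρ θ x₀ xstar P ℱ i j x z xt) (s : ℕ)
    (φ : E d → ℝ) : Integrable (fun ω => φ (xt ω s)) P :=
  ((H.finiteMeas_xt s 0).map φ).integrable (ℱ.le _) P

theorem integrable_increment (H : AsyncRun τ f h L γ μ ρ θ x₀ xstar P ℱ i j x z xt) (s : ℕ) {k : ℕ}
    (hk : k < n) (c : ℝ) : Integrable (fun ω => ‖c • (z ω s (k + 1) - z ω s k)‖ ^ 2) P :=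
  ((H.finiteMeas_z s le_rfl hk).map₂ (H.finiteMeas_z s k.le_succ hk)
    fun a b => ‖c • (a - b)‖ ^ 2).integrable (ℱ.le _) P

/-- For each fixed `r` the noise depends on the past alone, and the fresh index is uniform and
independent of that past. -/
theorem integral_stepNoise (H : AsyncRun τ f h L γ μ ρ θ x₀ xstar P ℱ i j x z xt) (s : ℕ) {k : ℕ}
    (hk : k < n) :
    Integrable (fun ω => stepNoise f L (θ s) xstar (delayedPoint θ j x z xt s k ω) (z ω s k)
      (xt ω s) (i s k ω)) P ∧
    ∫ ω, stepNoise f L (θ s) xstar (delayedPoint θ j x z xt s k ω) (z ω s k)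
      (xt ω s) (i s k ω) ∂P ≤ 0 := by
  have hw := H.finiteMeas_delayedPoint hk (fun l hl => H.finiteMeas_x s hl hk.le)
    (fun l hl => H.finiteMeas_z s hl hk.le) (H.finiteMeas_xt s k)
  have hN : ∀ r, FiniteMeas (ℱ (s * n + k)) fun ω => stepNoise f L (θ s) xstar
      (delayedPoint θ j x z xt s k ω) (z ω s k) (xt ω s) r := fun r =>
    hw.map₂ ((H.finiteMeas_z s le_rfl hk.le).map₂ (H.finiteMeas_xt s k) Prod.mk)
      fun a b => stepNoise f L (θ s) xstar a b.1 b.2 r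
  constructor
  · exact ((H.finiteMeas_index s hk).bind (G := fun r ω => stepNoise f L (θ s) xstar
      (delayedPoint θ j x z xt s k ω) (z ω s k) (xt ω s) r)
      fun r _ => (hN r).mono (ℱ.mono (Nat.le_succ _))).integrable (ℱ.le _) P
  · exact integral_uniform_index_le_zero P (ℱ.le _)
      ((H.sampling.i_meas s k hk).mono (ℱ.le _) le_rfl) (H.sampling.i_uniform s k hk)
      (H.sampling.i_indep s k hk) hN
      fun ω => sum_stepNoise_le_zero H.n_pos H.L_pos H.f_convex H.f_smooth _ _ _ _ _

/-- The expected decrease over one inner iteration. -/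
theorem expected_step_le (H : AsyncRun τ f h L γ μ ρ θ x₀ xstar P ℱ i j x z xt) (s : ℕ) {k : ℕ}
    (hk : k < n) :
    ∫ ω, (objective f h (x ω s (k + 1)) - objective f h xstar) ∂P
      ≤ 1 / 2 * ∫ ω, (objective f h (xt ω s) - objective f h xstar) ∂P
        + aCoef (θ s) * ∫ ω, (objective f h (x ω s k) - objective f h xstar) ∂P
        + θ s ^ 2 / (2 * γ) * (∫ ω, ‖z ω s k - xstar‖ ^ 2 ∂P
          - ρ * ∫ ω, ‖z ω s (k + 1) - xstar‖ ^ 2 ∂P)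
        + (2 * L - 1 / (2 * γ)) * ∫ ω, ‖θ s • (z ω s (k + 1) - z ω s k)‖ ^ 2 ∂P
        + 4 * L * τ * ∑ l ∈ Finset.Ico (k - τ) k,
            ∫ ω, ‖θ s • (z ω s (l + 1) - z ω s l)‖ ^ 2 ∂P := by
  have hpath : ∀ ω, objective f h (x ω s (k + 1)) - objective f h xstar
      ≤ 1 / 2 * (objective f h (xt ω s) - objective f h xstar)
        + aCoef (θ s) * (objective f h (x ω s k) - objective f h xstar)
        + θ s ^ 2 / (2 * γ) * (‖z ω s k - xstar‖ ^ 2 - ρ * ‖z ω s (k + 1) - xstar‖ ^ 2)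
        + (2 * L - 1 / (2 * γ)) * ‖θ s • (z ω s (k + 1) - z ω s k)‖ ^ 2
        + 4 * L * τ * ∑ l ∈ Finset.Ico (k - τ) k, ‖θ s • (z ω s (l + 1) - z ω s l)‖ ^ 2
        + stepNoise f L (θ s) xstar (delayedPoint θ j x z xt s k ω) (z ω s k)
          (xt ω s) (i s k ω) := fun ω => by
    have h1 := one_step_le H.n_pos H.L_pos H.γ_pos H.μ_nonneg (H.θ_pos s) (H.θ_le s) H.f_convex
      H.f_smooth H.h_convex xstar (delayedPoint θ j x z xt s k ω) (x ω s k) (z ω s k)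
      (z ω s (k + 1)) (xt ω s) (i s k ω) ((H.isRun ω).z_step s k hk)
    have h2 := norm_extrap_sub_compensated_sq_le ((H.isRun ω).x_step s) (H.θ_pos s) (H.θ_le s)
      (H.sampling.j_le s k hk ω) hk.le (H.sampling.j_delay s k hk ω)
    have h3 := mul_le_mul_of_nonneg_left h2 H.L_pos.le
    rw [← (H.isRun ω).x_step s k hk, ← H.ρ_eq s] at h1
    rw [delayedPoint] at *
    linarith
  have iP := H.integrable_xt s fun y => objective f h y - objective f h xstar
  have iX := H.integrable_x s hk.le fun y => objective f h y - objective f h xstar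
  have iZ := H.integrable_z s hk.le fun y => ‖y - xstar‖ ^ 2
  have iZ' := H.integrable_z s hk fun y => ‖y - xstar‖ ^ 2
  have iV := H.integrable_increment s hk (θ s)
  have iS : ∀ l ∈ Finset.Ico (k - τ) k,
      Integrable (fun ω => ‖θ s • (z ω s (l + 1) - z ω s l)‖ ^ 2) P := fun l hl =>
    H.integrable_increment s ((Finset.mem_Ico.1 hl).2.trans hk) (θ s)
  have iSum := integrable_finsetSum _ iS
  obtain ⟨iN, hN⟩ := H.integral_stepNoise s hk
  have i1 := (iP.const_mul (1 / 2)).add (iX.const_mul (aCoef (θ s)))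
  have i2 := i1.add ((iZ.sub (iZ'.const_mul ρ)).const_mul (θ s ^ 2 / (2 * γ)))
  have i3 := i2.add (iV.const_mul (2 * L - 1 / (2 * γ)))
  have i4 := i3.add (iSum.const_mul (4 * L * τ))
  have hmono := integral_mono
    (H.integrable_x s hk fun y => objective f h y - objective f h xstar) (i4.add iN) hpath
  rw [integral_add' i4 iN, integral_add' i3 (iSum.const_mul _), integral_add' i2 (iV.const_mul _),
    integral_add' i1 ((iZ.sub (iZ'.const_mul ρ)).const_mul _),
    integral_add' (iP.const_mul _) (iX.const_mul _), integral_const_mul, integral_const_mul,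
    integral_const_mul, integral_const_mul, integral_const_mul, integral_sub' iZ (iZ'.const_mul _),
    integral_const_mul, integral_finsetSum _ iS] at hmono
  linarith

/-- The expected decrease over one epoch. -/
theorem expected_epoch_le (H : AsyncRun τ f h L γ μ ρ θ x₀ xstar P ℱ i j x z xt)
    (hstep : 4 * γ * L + 8 * γ * L * (τ : ℝ) ^ 2 * ρ ^ n ≤ 1) (s : ℕ) :
    aCoef (θ s) * ρ ^ n * ∫ ω, (objective f h (x ω s n) - objective f h xstar) ∂P
      + (1 - aCoef (θ s) * ρ) * ∑ k ∈ Finset.range n, ρ ^ k *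
          ∫ ω, (objective f h (x ω s (k + 1)) - objective f h xstar) ∂P
      + θ s ^ 2 / (2 * γ) * (ρ ^ n * ∫ ω, ‖z ω s n - xstar‖ ^ 2 ∂P)
    ≤ 1 / 2 * (∑ k ∈ Finset.range n, ρ ^ k)
          * ∫ ω, (objective f h (xt ω s) - objective f h xstar) ∂P
      + aCoef (θ s) * ∫ ω, (objective f h (x ω s 0) - objective f h xstar) ∂P
      + θ s ^ 2 / (2 * γ) * ∫ ω, ‖z ω s 0 - xstar‖ ^ 2 ∂P :=
  epoch_sum_le (p := fun k => ∫ ω, (objective f h (x ω s k) - objective f h xstar) ∂P)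
    (R := fun k => ∫ ω, ‖z ω s k - xstar‖ ^ 2 ∂P)
    (q := fun k => ∫ ω, ‖θ s • (z ω s (k + 1) - z ω s k)‖ ^ 2 ∂P)
    H.L_pos.le H.γ_pos H.one_le_ρ hstep (fun _ => integral_nonneg fun _ => sq_nonneg _)
    fun _ hk => H.expected_step_le s hk

/-- Jensen's inequality for the snapshots. -/
theorem expected_snapshot_le (H : AsyncRun τ f h L γ μ ρ θ x₀ xstar P ℱ i j x z xt) (s : ℕ) :
    (∑ k ∈ Finset.range n, ρ ^ k)
        * ∫ ω, (objective f h (xt ω (s + 1)) - objective f h xstar) ∂P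
      ≤ ∑ k ∈ Finset.range n, ρ ^ k *
          ∫ ω, (objective f h (x ω s (k + 1)) - objective f h xstar) ∂P := by
  have hρ0 : 0 < ρ := zero_lt_one.trans_le H.one_le_ρ
  have hW : 0 < ∑ k ∈ Finset.range n, ρ ^ k :=
    Finset.sum_pos (fun k _ => pow_pos hρ0 k) (Finset.nonempty_range_iff.2 H.n_pos.ne')
  have hconv : ConvexOn ℝ Set.univ (objective f h) :=
    H.convexOn_h.add (convexOn_fAvg H.f_convex)
  have hpath : ∀ ω, (∑ k ∈ Finset.range n, ρ ^ k)
      * (objective f h (xt ω (s + 1)) - objective f h xstar)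
      ≤ ∑ k ∈ Finset.range n, ρ ^ k * (objective f h (x ω s (k + 1)) - objective f h xstar) :=
    fun ω => by
    have h1 := hconv.map_centerMass_le (t := Finset.range n) (w := fun k => ρ ^ k)
      (p := fun k => x ω s (k + 1)) (fun k _ => (pow_pos hρ0 k).le) hW fun _ _ => Set.mem_univ _
    rw [Finset.centerMass, ← (H.isRun ω).xt_sync s, Finset.centerMass, smul_eq_mul,
      inv_mul_eq_div, le_div_iff₀ hW] at h1
    simp only [mul_sub, Finset.sum_sub_distrib, ← Finset.sum_mul]
    simp only [Function.comp_apply, smul_eq_mul] at h1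
    linarith
  have iX : ∀ k ∈ Finset.range n, Integrable (fun ω =>
      ρ ^ k * (objective f h (x ω s (k + 1)) - objective f h xstar)) P := fun k hk =>
    (H.integrable_x s (Finset.mem_range.1 hk)
      fun y => objective f h y - objective f h xstar).const_mul _
  have hmono := integral_mono ((H.integrable_xt (s + 1)
    fun y => objective f h y - objective f h xstar).const_mul (∑ k ∈ Finset.range n, ρ ^ k))
    (integrable_finsetSum _ iX) hpath
  rw [integral_const_mul, integral_finsetSum _ iX] at hmono
  simpa only [integral_const_mul] using hmono

end AsyncRun

end AASVRG

/-! ### The two convergence bounds. -/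

theorem theorem3 {d n τ : ℕ} (hn : 0 < n)
    (f : Fin n → AASVRG.E d → ℝ) (h : AASVRG.E d → ℝ) {L γ : ℝ} (hL : 0 < L) (hγ : 0 < γ)
    (hf_conv : ∀ r, ConvexOn ℝ Set.univ (f r)) (hf_smooth : ∀ r, AASVRG.LSmooth L (f r))
    (hh_conv : ConvexOn ℝ Set.univ h)
    (x₀ xstar : AASVRG.E d) (hxstar : IsMinOn (AASVRG.objective f h) Set.univ xstar)
    {Ω : Type*} {mΩ : MeasurableSpace Ω} (P : Measure Ω) [IsProbabilityMeasure P]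
    (ℱ : Filtration ℕ mΩ) (i : ℕ → ℕ → Ω → Fin n) (j : ℕ → ℕ → Ω → ℕ)
    (hsamp : AASVRG.AsyncSampling P ℱ n τ i j)
    (x z : Ω → ℕ → ℕ → AASVRG.E d) (xt : Ω → ℕ → AASVRG.E d) (S : ℕ) :
    -- non-strongly convex case
    (∀ θ₁ : ℕ → ℝ, (∀ s : ℕ, θ₁ s = 2 / ((s : ℝ) + 4)) →
      5 * γ * L + 10 * γ * L * (τ : ℝ) ^ 2 ≤ 1 →
      (∀ ω, AASVRG.IsRun f h γ θ₁ 1 x₀ (fun s k => i s k ω) (fun s k => j s k ω)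
        (x ω) (z ω) (xt ω)) →
      (∀ k ∈ Finset.Icc 1 n, Integrable
        (fun ω => AASVRG.objective f h (x ω S k) - AASVRG.objective f h xstar) P) ∧
      (∫ ω, (AASVRG.objective f h (x ω S n) - AASVRG.objective f h xstar) ∂P)
          + (1 / 2 + θ₁ S) * ∑ k ∈ Finset.Icc 1 (n - 1),
              ∫ ω, (AASVRG.objective f h (x ω S k) - AASVRG.objective f h xstar) ∂P
        ≤ 2 * n * θ₁ S ^ 2 * (AASVRG.objective f h x₀ - AASVRG.objective f h xstar)
          + θ₁ S ^ 2 / (2 * γ) * ‖x₀ - xstar‖ ^ 2) ∧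
    -- strongly convex case
    (∀ μ θ θ₃ : ℝ, 0 < μ → StrongConvexOn Set.univ μ h →
      μ ≤ L * (τ : ℝ) ^ 2 / (4 * n) →
      5 * γ * L + 95 / 8 * (τ : ℝ) ^ 2 * γ * L ≤ 1 →
      θ = 1 / (τ : ℝ) * √(n * μ / L) →
      θ₃ = 1 + μ * γ / θ →
      (∀ ω, AASVRG.IsRun f h γ (fun _ => θ) θ₃ x₀ (fun s k => i s k ω) (fun s k => j s k ω)
        (x ω) (z ω) (xt ω)) →
      Integrable
        (fun ω => AASVRG.objective f h (xt ω (S + 1)) - AASVRG.objective f h xstar) P ∧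
      (∫ ω, (AASVRG.objective f h (xt ω (S + 1)) - AASVRG.objective f h xstar) ∂P)
        ≤ (θ₃ ^ (S * n))⁻¹ *
          ((1 + 1 / (n : ℝ)) * (AASVRG.objective f h x₀ - AASVRG.objective f h xstar)
            + 1 / (4 * n * γ) * ‖x₀ - xstar‖ ^ 2)) := by
  refine ⟨fun θ₁ hθ₁ hstep hrun => ?_, fun μ θ θ₃ hμ hh hμL hstep hθ hθ₃ hrun => ?_⟩
  -- With `μ = 0` the ratio `ρ` is `1` whatever `θ₁ s` is, so the snapshots are plain averages.
  · have H : AASVRG.AsyncRun τ f h L γ 0 1 θ₁ x₀ xstar P ℱ i j x z xt :=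
      { n_pos := hn, L_pos := hL, γ_pos := hγ, μ_nonneg := le_rfl, f_convex := hf_conv
        f_smooth := hf_smooth, h_convex := strongConvexOn_zero.2 hh_conv, isMinOn := hxstar
        sampling := hsamp
        θ_pos := fun s => by rw [hθ₁]; positivity
        θ_le := fun s => by
          rw [hθ₁, div_le_iff₀ (by positivity)]
          linarith [Nat.cast_nonneg (α := ℝ) s]
        ρ_eq := fun s => by simp
        isRun := hrun }
    have hγL : 0 < γ * L := mul_pos hγ hL
    have hstep' : 4 * γ * L + 8 * γ * L * (τ : ℝ) ^ 2 * 1 ^ n ≤ 1 := by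
      rw [one_pow]
      nlinarith [mul_nonneg hγL.le (sq_nonneg (τ : ℝ))]
    refine ⟨fun k hk => H.integrable_x S (Finset.mem_Icc.1 hk).2
      fun y => AASVRG.objective f h y - AASVRG.objective f h xstar, ?_⟩
    set p : ℕ → ℕ → ℝ := fun s k =>
      ∫ ω, (AASVRG.objective f h (x ω s k) - AASVRG.objective f h xstar) ∂P with hp
    have hp0 : ∀ s k, 0 ≤ p s k := fun s k => integral_nonneg fun ω => H.objective_sub_nonneg _
    have hsplit : ∀ s, ∑ k ∈ Finset.range n, p s (k + 1)
        = p s n + ∑ k ∈ Finset.Icc 1 (n - 1), p s k := fun s => by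
      obtain ⟨m, rfl⟩ : ∃ m, n = m + 1 := ⟨n - 1, by omega⟩
      rw [Finset.sum_range_succ, Nat.add_sub_cancel, add_comm, Finset.range_eq_Ico,
        Finset.sum_Ico_add' (fun k => p s k) 0 m 1]
      rfl
    have hchain := AASVRG.chain_convex (n := n) (γ := γ)
      (P₀ := AASVRG.objective f h x₀ - AASVRG.objective f h xstar) (R₀ := ‖x₀ - xstar‖ ^ 2)
      (θ := θ₁) (e := fun s => p s n) (T := fun s => ∑ k ∈ Finset.range n, p s (k + 1))
      (r := fun s => ∫ ω, ‖z ω s n - xstar‖ ^ 2 ∂P) hθ₁ (fun s => hp0 s n)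
      (fun s => by
        rw [hsplit]
        exact le_add_of_nonneg_right (Finset.sum_nonneg fun k _ => hp0 s k))
      (by
        have h0 := H.expected_epoch_le hstep' 0
        simp only [fun ω => (hrun ω).x_init, fun ω => (hrun ω).z_init,
          fun ω => (hrun ω).xt_init] at h0
        simpa using h0)
      (fun s => by
        have h1 := H.expected_epoch_le hstep' (s + 1)
        have h2 := H.expected_snapshot_le s
        simp only [fun ω => (hrun ω).x_sync s, fun ω => (hrun ω).z_sync s] at h1
        simp only [one_pow, one_mul, mul_one] at h1 h2
        simp only [hp]
        linarith)
      S
    have hr : 0 ≤ θ₁ S ^ 2 / (2 * γ) * ∫ ω, ‖z ω S n - xstar‖ ^ 2 ∂P :=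
      mul_nonneg (by positivity) (integral_nonneg fun ω => sq_nonneg _)
    rw [hsplit] at hchain
    linarith
  · obtain ⟨hθ0, hθle, hρ1, hstep', hdecay⟩ :=
      AASVRG.strongly_convex_parameters hn hL hγ hμ hμL hstep hθ hθ₃
    have H : AASVRG.AsyncRun τ f h L γ μ θ₃ (fun _ => θ) x₀ xstar P ℱ i j x z xt :=
      { n_pos := hn, L_pos := hL, γ_pos := hγ, μ_nonneg := hμ.le, f_convex := hf_conv
        f_smooth := hf_smooth, h_convex := hh, isMinOn := hxstar, sampling := hsamp
        θ_pos := fun _ => hθ0, θ_le := fun _ => hθle, ρ_eq := fun _ => hθ₃, isRun := hrun }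
    refine ⟨H.integrable_xt (S + 1)
      fun y => AASVRG.objective f h y - AASVRG.objective f h xstar, ?_⟩
    have hp0 : ∀ s k, 0 ≤ ∫ ω, (AASVRG.objective f h (x ω s k) - AASVRG.objective f h xstar) ∂P :=
      fun s k => integral_nonneg fun ω => H.objective_sub_nonneg _
    -- Here `e` and `r` are read at the start of each epoch, unlike the convex case, where they are
    -- read at its end.
    refine AASVRG.chain_strongly_convex (W := ∑ k ∈ Finset.range n, θ₃ ^ k)
      (e := fun s => ∫ ω, (AASVRG.objective f h (x ω s 0) - AASVRG.objective f h xstar) ∂P)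
      (T := fun s => ∑ k ∈ Finset.range n, θ₃ ^ k *
        ∫ ω, (AASVRG.objective f h (x ω s (k + 1)) - AASVRG.objective f h xstar) ∂P)
      (r := fun s => ∫ ω, ‖z ω s 0 - xstar‖ ^ 2 ∂P)
      (pt := fun s => ∫ ω, (AASVRG.objective f h (xt ω s) - AASVRG.objective f h xstar) ∂P)
      hn hγ hθ0 hθle hρ1 hdecay ?_ (H.objective_sub_nonneg x₀) (sq_nonneg _)
      (fun s => Finset.sum_nonneg fun k _ => mul_nonneg (by positivity) (hp0 s (k + 1)))
      (fun s => hp0 s 0) (fun s => integral_nonneg fun ω => sq_nonneg _)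
      ?_ ?_ ?_ (fun s => H.expected_snapshot_le s) (fun s => ?_) S
    · have h1 : ∑ k ∈ Finset.range n, (1 : ℝ) ≤ ∑ k ∈ Finset.range n, θ₃ ^ k :=
        Finset.sum_le_sum fun k _ => one_le_pow₀ hρ1
      simpa using h1
    · simp [fun ω => (hrun ω).x_init]
    · simp [fun ω => (hrun ω).z_init]
    · simp [fun ω => (hrun ω).xt_init]
    · simpa only [fun ω => (hrun ω).x_sync s, fun ω => (hrun ω).z_sync s]
        using H.expected_epoch_le hstep' s
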